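/- Let $g:\mathbb R\to(0,\infty)$ be a probability density with $\int x g(x)\,dx=0$ and put $\mu(x)=\int_{-\infty}^x s g(s)\,ds$. On $(-\infty,0]$ the function $\mu$ is strictly decreasing and on $[0,\infty)$ it is strictly increasing, each time with range $[\mu(0),0)$; write $\mu^{-1}$ for either of the two inverse branches on $[\mu(0),0)$. Assume (A1) (i) $x^2g(x)$ is bounded on $\mathbb R$, and for each of the two branches the functions $y\mapsto \mu^{-1}(y)\,g(\mu^{-1}(y))$ and $y\mapsto(\mu^{-1}(y))^2g(\mu^{-1}(y))$ are uniformly continuous on $[\mu(0),0)$; (ii) $\lim_{d\to0}\sup_{x\in\mathbb R}|x|\int_0^1|xg(x)-(x+hxd)\,g(x+hxd)|\,dh=0$; (iii) $\int|x|^{2+\kappa}g(x)\,dx<\infty$ for some $\kappa>0$. On a probability space let $\eta_1,\eta_2,\dots$ be i.i.d. with density $g$, and let $\gamma_{nt},\delta_{nt}$ ($1\le t\le n$) be real random variables such that $\eta_t$ is independent of $(\gamma_{nt},\delta_{nt})$ for $1\le t\le n$. Let $\mathcal A_{nt}$ ($1\le t\le n$) be sub-$\sigma$-fields with $\mathcal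 A_{nt}\subset\mathcal A_{n(t+1)}$ and $\mathcal A_{nt}\subset\mathcal A_{(n+1)t}$ for $1\le t\le n-1$, such that for $1\le j\le n$ the variables $\gamma_{nt},\delta_{nt}$ ($1\le t\le j$) and $\eta_1,\dots,\eta_{j-1}$ are $\mathcal A_{nj}$-measurable. Let $q>2$, $0<a<q/2$ and $C_n=\sum_{t=1}^n E|\gamma_{nt}|^q$, and assume, as $n\to\infty$, 1. $C_n/n^{q/2-a}=o(1)$; 2. $\big(n^{-1}\sum_{t=1}^n\gamma_{nt}^2\big)^{1/2}=\Gamma+o_P(1)$ for some random variable $\Gamma$ that is almost surely positive; 3. $E\big[\big(n^{-1}\sum_{t=1}^n\gamma_{nt}^2\big)^{q/2}\big]=O(1)$; 4. $\max_{1\le t\le n}n^{-1/2}|\gamma_{nt}|=o_P(1)$; 5. $\max_{1\le t\le n}|\delta_{nt}|=o_P(1)$; 6. $\dfrac{n^{q/2-a}}{C_n}\,E\Big[\big(n^{-1}\sum_{t=1}^n\gamma_{nt}^2|\delta_{nt}|\big)^{q/2}\Big]=o(1)$; 7. $n^{-1/2}\sum_{t=1}^n|\gamma_{nt}\delta_{nt}|=O_P(1)$.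 Define $$\tilde V_n(x)=n^{-1/2}\sum_{t=1}^n\gamma_{nt}\eta_t I(\eta_t<x+x\delta_{nt}),\qquad V_n^*(x)=n^{-1/2}\sum_{t=1}^n\gamma_{nt}\eta_t I(\eta_t\le x),$$ $$\tilde J_n(x)=n^{-1/2}\sum_{t=1}^n\gamma_{nt}\,\mu(x+x\delta_{nt}),\qquad J_n^*(x)=n^{-1/2}\sum_{t=1}^n\gamma_{nt}\,\mu(x).$$ Then $$\sup_{x\in\mathbb R}\Big|\tilde J_n(x)-J_n^*(x)-x^2g(x)\,n^{-1/2}\sum_{t=1}^n\gamma_{nt}\delta_{nt}\Big|=o_P(1).$$ If, moreover, $\eta_t$ is independent of $\mathcal A_{nt}$ for all $1\le t\le n$, then also $$\sup_{x\in\mathbb R}\Big|\tilde V_n(x)-V_n^*(x)-x^2g(x)\,n^{-1/2}\sum_{t=1}^n\gamma_{nt}\delta_{nt}\Big|=o_P(1).$$ (The suprema need not be measurable; $o_P(1)$ is understood with outer probability.) -/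

import Mathlib

open MeasureTheory ProbabilityTheory Filter Topology
open scoped ENNReal NNReal

noncomputable section

namespace MixedEmpirical

/-- The partial first moment function `μ(x) = ∫_{-∞}^x s g(s) ds` of the density `g`. -/
def mu (g : ℝ → ℝ) (x : ℝ) : ℝ := ∫ s in Set.Iic x, s * g s

/-- The inverse of `μ` with values in `(-∞, 0]`. -/
def muInvNeg (g : ℝ → ℝ) : ℝ → ℝ := Function.invFunOn (mu g) (Set.Iic 0)

/-- The inverse of `μ` with values in `[0, ∞)`. -/
def muInvPos (g : ℝ → ℝ) : ℝ → ℝ := Function.invFunOn (mu g) (Set.Ici 0)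

/-- `g` is a measurable, everywhere positive function with `∫ s g(s) ds = 0`
(that it integrates to one is part of its being the density of the errors). -/
structure IsCenteredPosDensity (g : ℝ → ℝ) : Prop where
  measurable : Measurable g
  pos : ∀ x, 0 < g x
  mean_zero : ∫ x, x * g x = 0

/-- Assumption (A1) on the error density `g`. For a centered positive density each branch of the
inverse of `μ` is defined on `[μ(0), 0)`, the value `0` being the limit of `μ` at `±∞`. -/
structure AssumptionA1 (g : ℝ → ℝ) : Prop where
  bounded : ∃ B : ℝ, ∀ x, x ^ 2 * g x ≤ B
  unifCont_neg_one : UniformContinuousOn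
    (fun y => muInvNeg g y * g (muInvNeg g y)) (Set.Ico (mu g 0) 0)
  unifCont_neg_two : UniformContinuousOn
    (fun y => muInvNeg g y ^ 2 * g (muInvNeg g y)) (Set.Ico (mu g 0) 0)
  unifCont_pos_one : UniformContinuousOn
    (fun y => muInvPos g y * g (muInvPos g y)) (Set.Ico (mu g 0) 0)
  unifCont_pos_two : UniformContinuousOn
    (fun y => muInvPos g y ^ 2 * g (muInvPos g y)) (Set.Ico (mu g 0) 0)
  scale_smooth : Tendsto
    (fun d : ℝ => ⨆ x : ℝ, ENNReal.ofReal |x| *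
      ∫⁻ h in Set.Icc (0 : ℝ) 1,
        ENNReal.ofReal |x * g x - (x + h * x * d) * g (x + h * x * d)|)
    (𝓝[≠] 0) (𝓝 0)
  moment : ∃ κ : ℝ, 0 < κ ∧ Integrable (fun x => |x| ^ (2 + κ) * g x)

variable {Ω : Type*}

/-- `Y_n = o_P(1)` for `[0, ∞]`-valued quantities (such as suprema of absolute values). For a set
that is not measurable, `P` is the outer probability. -/
def IsLittleOPOne [MeasurableSpace Ω] (P : Measure Ω) (Y : ℕ → Ω → ℝ≥0∞) : Prop :=
  ∀ ε : ℝ≥0∞, 0 < ε → Tendsto (fun n => P {ω | ε ≤ Y n ω}) atTop (𝓝 0)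

/-- `Y_n = O_P(1)` for real random variables. -/
def IsBigOPOne [MeasurableSpace Ω] (P : Measure Ω) (Y : ℕ → Ω → ℝ) : Prop :=
  ∀ ε : ℝ≥0∞, 0 < ε → ∃ M : ℝ, ∀ᶠ n in atTop, P {ω | M < |Y n ω|} ≤ ε

/-- The probabilistic setup: i.i.d. errors `η_1, η_2, …` with density `g`, weights `γ_{nt}`,
perturbations `δ_{nt}` (`1 ≤ t ≤ n`) with `η_t` independent of `(γ_{nt}, δ_{nt})`, and an array of
sub-σ-fields `A_{nt}`, increasing in `n` and in `t`, to which these variables are adapted. Indices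
outside `1 ≤ t ≤ n` play no role. -/
structure Setup [mΩ : MeasurableSpace Ω] (P : Measure Ω) (g : ℝ → ℝ) (η : ℕ → Ω → ℝ)
    (γ δ : ℕ → ℕ → Ω → ℝ) (A : ℕ → ℕ → MeasurableSpace Ω) : Prop where
  measurable_eta : ∀ t, 1 ≤ t → Measurable (η t)
  law_eta : ∀ t, 1 ≤ t → P.map (η t) = volume.withDensity (fun x => ENNReal.ofReal (g x))
  iIndep_eta : iIndepFun (fun k : ℕ => η (k + 1)) P
  indep_weights : ∀ n t, 1 ≤ t → t ≤ n → IndepFun (η t) (fun ω => (γ n t ω, δ n t ω)) P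
  sub : ∀ n t, 1 ≤ t → t ≤ n → A n t ≤ mΩ
  mono_right : ∀ n t, 1 ≤ t → t + 1 ≤ n → A n t ≤ A n (t + 1)
  mono_left : ∀ n t, 1 ≤ t → t + 1 ≤ n → A n t ≤ A (n + 1) t
  adapted_gamma : ∀ n t j, 1 ≤ t → t ≤ j → j ≤ n → Measurable[A n j] (γ n t)
  adapted_delta : ∀ n t j, 1 ≤ t → t ≤ j → j ≤ n → Measurable[A n j] (δ n t)
  adapted_eta : ∀ n t j, 1 ≤ t → t < j → j ≤ n → Measurable[A n j] (η t)

/-- `C_n = ∑_{t=1}^n E|γ_{nt}|^q`. -/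
def weightMoment [MeasurableSpace Ω] (P : Measure Ω) (γ : ℕ → ℕ → Ω → ℝ) (q : ℝ) (n : ℕ) : ℝ≥0∞ :=
  ∑ t ∈ Finset.Icc 1 n, ∫⁻ ω, ENNReal.ofReal (|γ n t ω| ^ q) ∂P

/-- The conditions on the weights `γ_{nt}` and the perturbations `δ_{nt}`, with exponents
`q` and `a`. -/
structure WeightConditions [MeasurableSpace Ω] (P : Measure Ω) (γ δ : ℕ → ℕ → Ω → ℝ)
    (q a : ℝ) : Prop where
  two_lt : 2 < q
  a_pos : 0 < a
  a_lt : a < q / 2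
  moment_rate :
    Tendsto (fun n : ℕ => weightMoment P γ q n / (n : ℝ≥0∞) ^ (q / 2 - a)) atTop (𝓝 0)
  mean_square : ∃ Γ : Ω → ℝ, Measurable Γ ∧ (∀ᵐ ω ∂P, 0 < Γ ω) ∧
    IsLittleOPOne P (fun n ω => ENNReal.ofReal
      |√((n : ℝ)⁻¹ * ∑ t ∈ Finset.Icc 1 n, γ n t ω ^ 2) - Γ ω|)
  moment_bounded : ∃ K : ℝ≥0, ∀ᶠ n : ℕ in atTop,
    ∫⁻ ω, ENNReal.ofReal (((n : ℝ)⁻¹ * ∑ t ∈ Finset.Icc 1 n, γ n t ω ^ 2) ^ (q / 2)) ∂P ≤ K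
  max_gamma : IsLittleOPOne P
    (fun n ω => ⨆ t ∈ Finset.Icc 1 n, ENNReal.ofReal ((√(n : ℝ))⁻¹ * |γ n t ω|))
  max_delta : IsLittleOPOne P
    (fun n ω => ⨆ t ∈ Finset.Icc 1 n, ENNReal.ofReal |δ n t ω|)
  mixed_moment : Tendsto (fun n : ℕ => (n : ℝ≥0∞) ^ (q / 2 - a) / weightMoment P γ q n *
    ∫⁻ ω, ENNReal.ofReal
      (((n : ℝ)⁻¹ * ∑ t ∈ Finset.Icc 1 n, γ n t ω ^ 2 * |δ n t ω|) ^ (q / 2)) ∂P)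
    atTop (𝓝 0)
  gamma_delta : IsBigOPOne P
    (fun n ω => (√(n : ℝ))⁻¹ * ∑ t ∈ Finset.Icc 1 n, |γ n t ω * δ n t ω|)

/-- `Ṽ_n(x) = n^{-1/2} ∑_{t=1}^n γ_{nt} η_t I(η_t < x + x δ_{nt})`. -/
def Vtilde (η : ℕ → Ω → ℝ) (γ δ : ℕ → ℕ → Ω → ℝ) (n : ℕ) (x : ℝ) (ω : Ω) : ℝ :=
  (√(n : ℝ))⁻¹ * ∑ t ∈ Finset.Icc 1 n,
    γ n t ω * η t ω * (Set.Iio (x + x * δ n t ω)).indicator 1 (η t ω)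

/-- `J̃_n(x) = n^{-1/2} ∑_{t=1}^n γ_{nt} μ(x + x δ_{nt})`. -/
def Jtilde (g : ℝ → ℝ) (γ δ : ℕ → ℕ → Ω → ℝ) (n : ℕ) (x : ℝ) (ω : Ω) : ℝ :=
  (√(n : ℝ))⁻¹ * ∑ t ∈ Finset.Icc 1 n, γ n t ω * mu g (x + x * δ n t ω)

/-- `V*_n(x) = n^{-1/2} ∑_{t=1}^n γ_{nt} η_t I(η_t ≤ x)`. -/
def Vstar (η : ℕ → Ω → ℝ) (γ : ℕ → ℕ → Ω → ℝ) (n : ℕ) (x : ℝ) (ω : Ω) : ℝ :=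
  (√(n : ℝ))⁻¹ * ∑ t ∈ Finset.Icc 1 n,
    γ n t ω * η t ω * (Set.Iic x).indicator 1 (η t ω)

/-- `J*_n(x) = n^{-1/2} ∑_{t=1}^n γ_{nt} μ(x)`. -/
def Jstar (g : ℝ → ℝ) (γ : ℕ → ℕ → Ω → ℝ) (n : ℕ) (x : ℝ) (ω : Ω) : ℝ :=
  (√(n : ℝ))⁻¹ * ∑ t ∈ Finset.Icc 1 n, γ n t ω * mu g x

/-- The linear term `x² g(x) n^{-1/2} ∑_{t=1}^n γ_{nt} δ_{nt}`. -/
def linTerm (g : ℝ → ℝ) (γ δ : ℕ → ℕ → Ω → ℝ) (n : ℕ) (x : ℝ) (ω : Ω) : ℝ :=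
  x ^ 2 * g x * ((√(n : ℝ))⁻¹ * ∑ t ∈ Finset.Icc 1 n, γ n t ω * δ n t ω)

end MixedEmpirical

end

/-! The statement on `Jtilde` is a first-order expansion. With `f s = s * g s`, the error `μ(x + xd)
- μ(x) - x² g(x) d` equals `xd ∫₀¹ (f(x + hxd) - f(x)) dh`, which is `|d| * o(1)` uniformly in `x`
by scale smoothness (`abs_mu_sub_linear_le`). Since `max |δ| = o_P(1)` and `n^{-1/2} ∑ |γ δ| =
O_P(1)`, the weighted sum of these errors vanishes.

It remains to show that `Vtilde - Vstar - (Jtilde - Jstar)` is uniformly negligible. Because `η_t`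
is independent of `A n t`, the `J` terms are the conditional means of the `V` terms, and the
difference is a sum of conditionally centered summands. Off an event of small probability one may
assume that the normalized weights are at most `n^{-a/q}`, that their squares sum to at most a
constant `K`, that `|δ| ≤ Δ`, and that no summand exceeds a level `c = n^{-b}`. Under these
deterministic bounds a supermartingale argument gives a Bernstein-type inequality
(`AdaptedArray.measure_abs_ge_le`).

The map `squash` turns the index `x` into `u ∈ (0, 1)` and the dilation by `1 + δ` into a shift of
size at most `|δ|`. Boundedness of `x² g(x)` and the moment of order `2 + κ` make the second moment
of the error over a `u`-interval of length `w` at most `C w^β` (`exists_tameLaw`). Hence dyadic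
chaining works for both processes from a fixed level `k₀` down to a level `k₁` of order `log n`;
beyond `k₁` the oscillation is dominated by sums of absolute values. At the `2^{k₀}` coarse points
the two processes differ only through errors within `Δ` of `u` after `squash`, so the variance of
the difference is small with `Δ` (`TameLaw.measure_perturbation_le`). The constants are fixed in the
order `K`, `k₀`, `Δ`, and then `n` tends to infinity. -/

namespace MixedEmpirical

/-! ### Conditioning by freezing, and an exponential inequality for adapted sums. -/

/-- Freezing: integrating a function of independent `Y` and `X`. -/
theorem lintegral_comp_prodMk_of_indepFun {Ω Ω' : Type*} [MeasurableSpace Ω] [MeasurableSpace Ω']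
    {P : Measure Ω} [IsProbabilityMeasure P] {Y : Ω → Ω'} {X : Ω → ℝ} (hY : Measurable Y)
    (hX : Measurable X) (h : IndepFun Y X P) {F : Ω' × ℝ → ℝ≥0∞} (hF : Measurable F) :
    ∫⁻ ω, F (Y ω, X ω) ∂P = ∫⁻ ω, ∫⁻ y, F (Y ω, y) ∂(P.map X) ∂P := by
  have hprod := (indepFun_iff_map_prod_eq_prod_map_map hY.aemeasurable hX.aemeasurable).1 h
  have : IsProbabilityMeasure (P.map X) := Measure.isProbabilityMeasure_map hX.aemeasurable
  have : IsProbabilityMeasure (P.map Y) := Measure.isProbabilityMeasure_map hY.aemeasurable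
  rw [← lintegral_map (f := F) (g := fun ω => (Y ω, X ω)) hF (hY.prodMk hX), hprod,
    lintegral_prod _ hF.aemeasurable,
    lintegral_map (f := fun a => ∫⁻ y, F (a, y) ∂(P.map X)) hF.lintegral_prod_right' hY]

/-- Freezing with respect to a sub-σ-field independent of `X`. -/
theorem lintegral_freeze {Ω : Type*} {m mΩ : MeasurableSpace Ω} {P : Measure Ω}
    [IsProbabilityMeasure P] (hm : m ≤ mΩ) {X : Ω → ℝ} (hX : Measurable X)
    (h : Indep (MeasurableSpace.comap X inferInstance) m P) {F : Ω × ℝ → ℝ≥0∞}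
    (hF : @Measurable _ _ (@Prod.instMeasurableSpace _ _ m _) _ F) :
    ∫⁻ ω, F (ω, X ω) ∂P = ∫⁻ ω, ∫⁻ y, F (ω, y) ∂(P.map X) ∂P := by
  have hid : @Measurable _ _ mΩ m (id : Ω → Ω) := fun s hs => hm s hs
  refine @lintegral_comp_prodMk_of_indepFun Ω Ω mΩ m P _ id X hid hX ?_ F hF
  rw [@IndepFun_iff_Indep _ _ _ mΩ m _ id X P, MeasurableSpace.comap_id]
  exact h.symm

/-- Errors `η_t` with law `ν`, independent of `A_t`, and adapted random parameters `W_t`. -/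
structure AdaptedArray {Ω : Type*} [mΩ : MeasurableSpace Ω] (P : Measure Ω) (ν : Measure ℝ)
    (η : ℕ → Ω → ℝ) (W : ℕ → Ω → ℝ × ℝ) (A : ℕ → MeasurableSpace Ω) (n : ℕ) : Prop where
  sub : ∀ t, 1 ≤ t → t ≤ n → A t ≤ mΩ
  meas : ∀ t, 1 ≤ t → t ≤ n → Measurable (η t)
  law : ∀ t, 1 ≤ t → t ≤ n → P.map (η t) = ν
  indep : ∀ t, 1 ≤ t → t ≤ n → Indep (MeasurableSpace.comap (η t) inferInstance) (A t) P
  weights : ∀ t j, 1 ≤ t → t ≤ j → j ≤ n → Measurable[A j] (W t)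
  past : ∀ t j, 1 ≤ t → t < j → j ≤ n → Measurable[A j] (η t)

/-- The sum of `h(W_t, η_t)`, centered at its conditional expectations. -/
noncomputable def centeredSum {Ω : Type*} (ν : Measure ℝ) (η : ℕ → Ω → ℝ) (W : ℕ → Ω → ℝ × ℝ)
    (n : ℕ) (h : (ℝ × ℝ) × ℝ → ℝ) (ω : Ω) : ℝ :=
  ∑ t ∈ Finset.Icc 1 n, (h (W t ω, η t ω) - ∫ y, h (W t ω, y) ∂ν)

theorem centeredSum_neg {Ω : Type*} {ν : Measure ℝ} {η : ℕ → Ω → ℝ} {W : ℕ → Ω → ℝ × ℝ} {n : ℕ}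
    (h : (ℝ × ℝ) × ℝ → ℝ) (ω : Ω) :
    centeredSum ν η W n (fun p => -h p) ω = -centeredSum ν η W n h ω := by
  simp only [centeredSum, integral_neg, ← Finset.sum_neg_distrib]
  exact Finset.sum_congr rfl fun _ _ => by ring

/-- Since `|f - m| ≤ 1`, the bound `e^z ≤ 1 + z + z²` gives `E e^{f - m} ≤ 1 + Var f ≤ 1 + E f² ≤
exp (E f²)`. -/
theorem lintegral_exp_centered_le_one {ν : Measure ℝ} [IsProbabilityMeasure ν] {f : ℝ → ℝ}
    (hf : Measurable f) (hb : ∀ y, |f y| ≤ 1 / 2) :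
    ∫⁻ y, ENNReal.ofReal (Real.exp (f y - ∫ x, f x ∂ν - ∫ x, f x ^ 2 ∂ν)) ∂ν ≤ 1 := by
  set m := ∫ x, f x ∂ν with hm
  have hfi : Integrable f ν := Integrable.of_bound hf.aestronglyMeasurable (1 / 2)
    (ae_of_all _ fun y => by simpa using hb y)
  have hf2 : Integrable (fun y => f y ^ 2) ν :=
    Integrable.of_bound (hf.pow_const 2).aestronglyMeasurable (1 / 4)
    (ae_of_all _ fun y => by
      rw [Real.norm_eq_abs, abs_pow]; nlinarith [hb y, abs_nonneg (f y)])
  have hmb : |m| ≤ 1 / 2 := by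
    have := norm_integral_le_of_norm_le_const (μ := ν) (f := f) (C := 1 / 2)
      (ae_of_all _ fun y => by simpa using hb y)
    simpa using this
  have key : ∀ y, Real.exp (f y - m) ≤ 1 + (f y - m) + (f y - m) ^ 2 := fun y => by
    have h1 : |f y - m| ≤ 1 := (abs_sub _ _).trans (by linarith [hb y])
    have := (abs_le.1 (Real.abs_exp_sub_one_sub_id_le h1)).2
    linarith
  set v := ∫ x, f x ^ 2 ∂ν with hv
  have hint : Integrable (fun y => 1 + (f y - m) + (f y - m) ^ 2) ν := by
    have : (fun y => 1 + (f y - m) + (f y - m) ^ 2)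
        = fun y => (1 - m + m ^ 2) + (1 - 2 * m) * f y + f y ^ 2 := by ext; ring
    rw [this]
    exact ((integrable_const _).add (hfi.const_mul _)).add hf2
  have hval : ∫ y, (1 + (f y - m) + (f y - m) ^ 2) ∂ν ≤ 1 + v := by
    have : (fun y => 1 + (f y - m) + (f y - m) ^ 2)
        = fun y => (1 - m + m ^ 2) + (1 - 2 * m) * f y + f y ^ 2 := by ext; ring
    have h1 : Integrable (fun y => (1 - m + m ^ 2) + (1 - 2 * m) * f y) ν :=
      (integrable_const _).add (hfi.const_mul _)
    rw [this, integral_add h1 hf2, integral_add (integrable_const _) (hfi.const_mul _),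
      integral_const, integral_const_mul, ← hm, ← hv]
    simp only [probReal_univ, one_smul]
    nlinarith [sq_nonneg m]
  calc ∫⁻ y, ENNReal.ofReal (Real.exp (f y - m - v)) ∂ν
      ≤ ∫⁻ y, ENNReal.ofReal (Real.exp (-v)) *
          ENNReal.ofReal (1 + (f y - m) + (f y - m) ^ 2) ∂ν := by
        refine lintegral_mono fun y => ?_
        rw [← ENNReal.ofReal_mul (Real.exp_pos _).le]
        refine ENNReal.ofReal_le_ofReal ?_
        rw [show f y - m - v = -v + (f y - m) by ring, Real.exp_add]
        exact mul_le_mul_of_nonneg_left (key y) (Real.exp_pos _).le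
    _ = ENNReal.ofReal (Real.exp (-v)) *
          ENNReal.ofReal (∫ y, (1 + (f y - m) + (f y - m) ^ 2) ∂ν) := by
        rw [lintegral_const_mul' _ _ ENNReal.ofReal_ne_top, ofReal_integral_eq_lintegral_ofReal hint
          (ae_of_all _ fun y => (Real.exp_pos _).le.trans (key y))]
    _ ≤ ENNReal.ofReal (Real.exp (-v)) * ENNReal.ofReal (Real.exp v) := by
        gcongr
        exact hval.trans (by linarith [Real.add_one_le_exp v])
    _ = 1 := by
        rw [← ENNReal.ofReal_mul (Real.exp_pos _).le, ← Real.exp_add]; simp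

section

variable {Ω : Type*} [mΩ : MeasurableSpace Ω] {P : Measure Ω} [IsProbabilityMeasure P]
  {ν : Measure ℝ} [IsProbabilityMeasure ν] {η : ℕ → Ω → ℝ} {W : ℕ → Ω → ℝ × ℝ}
  {A : ℕ → MeasurableSpace Ω} {n : ℕ}

theorem measurable_integral_param {f : (ℝ × ℝ) × ℝ → ℝ} (hf : Measurable f) :
    Measurable fun w => ∫ y, f (w, y) ∂ν :=
  (hf.stronglyMeasurable.integral_prod_right' (ν := ν)).measurable

/-- The exponentials form a supermartingale started at 1: freezing the past at step `j + 1` leaves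
an inner integral over the new error, which is at most 1 by `lintegral_exp_centered_le_one`. -/
theorem AdaptedArray.lintegral_exp_le_one (H : AdaptedArray P ν η W A n)
    {f : (ℝ × ℝ) × ℝ → ℝ} (hf : Measurable f) (hb : ∀ p, |f p| ≤ 1 / 2) {j : ℕ} (hj : j ≤ n) :
    ∫⁻ ω, ENNReal.ofReal (Real.exp (∑ t ∈ Finset.Icc 1 j, (f (W t ω, η t ω)
      - ∫ y, f (W t ω, y) ∂ν - ∫ y, f (W t ω, y) ^ 2 ∂ν))) ∂P ≤ 1 := by
  have hI1 := measurable_integral_param (ν := ν) hf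
  have hI2 := measurable_integral_param (ν := ν) (hf.pow_const 2)
  induction j with
  | zero => simp
  | succ j ih =>
    have ih := ih (by omega)
    have h1 : 1 ≤ j + 1 := by omega
    set S : Ω → ℝ := fun ω => ∑ t ∈ Finset.Icc 1 j, (f (W t ω, η t ω)
      - ∫ y, f (W t ω, y) ∂ν - ∫ y, f (W t ω, y) ^ 2 ∂ν) with hS
    have hSm : Measurable[A (j + 1)] S := by
      refine Finset.measurable_fun_sum (m := A (j + 1)) _ fun t ht => ?_
      rw [Finset.mem_Icc] at ht
      have hw := H.weights t (j + 1) ht.1 (by omega) hj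
      have he := H.past t (j + 1) ht.1 (by omega) hj
      refine Measurable.sub (Measurable.sub ?_ ?_) ?_
      · exact hf.comp (Measurable.prodMk hw he)
      · exact hI1.comp hw
      · exact hI2.comp hw
    have hWm := H.weights (j + 1) (j + 1) h1 le_rfl hj
    let F : Ω × ℝ → ℝ≥0∞ := fun p => ENNReal.ofReal (Real.exp (S p.1 + (f (W (j + 1) p.1, p.2)
      - ∫ y, f (W (j + 1) p.1, y) ∂ν - ∫ y, f (W (j + 1) p.1, y) ^ 2 ∂ν)))
    have hF : @Measurable _ _ (@Prod.instMeasurableSpace _ _ (A (j + 1)) _) _ F := by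
      let _ : MeasurableSpace Ω := A (j + 1)
      have hW1 : Measurable fun p : Ω × ℝ => W (j + 1) p.1 := hWm.comp measurable_fst
      exact ENNReal.measurable_ofReal.comp (Real.measurable_exp.comp
        ((hSm.comp measurable_fst).add (((hf.comp (hW1.prodMk measurable_snd)).sub
          (hI1.comp hW1)).sub (hI2.comp hW1))))
    calc _ = ∫⁻ ω, F (ω, η (j + 1) ω) ∂P := by
          refine lintegral_congr fun ω => ?_
          rw [Finset.sum_Icc_succ_top h1]
      _ = ∫⁻ ω, ∫⁻ y, F (ω, y) ∂ν ∂P := by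
          rw [lintegral_freeze (H.sub _ h1 hj) (H.meas _ h1 hj) (H.indep _ h1 hj) hF,
            H.law _ h1 hj]
      _ ≤ ∫⁻ ω, ENNReal.ofReal (Real.exp (S ω)) ∂P := by
          refine lintegral_mono fun ω => ?_
          have := lintegral_exp_centered_le_one (ν := ν)
            (f := fun y => f (W (j + 1) ω, y)) (hf.comp measurable_prodMk_left) (fun y => hb _)
          simp only [F, Real.exp_add, ENNReal.ofReal_mul (Real.exp_pos _).le]
          rw [lintegral_const_mul' _ _ ENNReal.ofReal_ne_top]
          exact mul_le_of_le_one_right' this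
      _ ≤ 1 := ih

/-- Chernoff's bound. The variance bound `V` holds for every `ω`, so the random compensator in the
supermartingale can be replaced by `l² V`. -/
theorem AdaptedArray.measure_ge_le (H : AdaptedArray P ν η W A n)
    {h : (ℝ × ℝ) × ℝ → ℝ} (hh : Measurable h) {c l V ε : ℝ} (hc : ∀ p, |h p| ≤ c) (hl : 0 ≤ l)
    (hlc : 2 * l * c ≤ 1) (hV : ∀ ω, ∑ t ∈ Finset.Icc 1 n, ∫ y, h (W t ω, y) ^ 2 ∂ν ≤ V) :
    P {ω | ε ≤ centeredSum ν η W n h ω} ≤ ENNReal.ofReal (Real.exp (-l * ε + l ^ 2 * V)) := by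
  have h1 := H.lintegral_exp_le_one (f := fun p => l * h p) (hh.const_mul l) (fun p => by
    rw [abs_mul, abs_of_nonneg hl]
    nlinarith [mul_le_mul_of_nonneg_left (hc p) hl]) le_rfl
  set Z : Ω → ℝ≥0∞ := fun ω => ENNReal.ofReal (Real.exp (∑ t ∈ Finset.Icc 1 n,
      (l * h (W t ω, η t ω) - ∫ y, l * h (W t ω, y) ∂ν - ∫ y, (l * h (W t ω, y)) ^ 2 ∂ν)))
  have hsub : {ω | ε ≤ centeredSum ν η W n h ω} ⊆
      {ω | ENNReal.ofReal (Real.exp (l * ε - l ^ 2 * V)) ≤ Z ω} := by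
    intro ω hω
    refine ENNReal.ofReal_le_ofReal (Real.exp_le_exp.2 ?_)
    simp only [Set.mem_ofPred_eq, centeredSum] at hω
    simp only [integral_const_mul, mul_pow, Finset.sum_sub_distrib, ← Finset.mul_sum] at hω ⊢
    nlinarith [mul_le_mul_of_nonneg_left hω hl, mul_le_mul_of_nonneg_left (hV ω) (sq_nonneg l)]
  have hZ : AEMeasurable Z P := by
    refine (ENNReal.measurable_ofReal.comp (Real.measurable_exp.comp
      (Finset.measurable_fun_sum _ fun t ht => ?_))).aemeasurable
    rw [Finset.mem_Icc] at ht
    have hw : Measurable (W t) := (H.weights t t ht.1 le_rfl ht.2).mono (H.sub t ht.1 ht.2) le_rfl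
    have hf := hh.const_mul l
    exact ((hf.comp (hw.prodMk (H.meas t ht.1 ht.2))).sub
      ((measurable_integral_param hf).comp hw)).sub
      ((measurable_integral_param (hf.pow_const 2)).comp hw)
  have h2 := mul_meas_ge_le_lintegral₀ hZ (ENNReal.ofReal (Real.exp (l * ε - l ^ 2 * V)))
  calc P {ω | ε ≤ centeredSum ν η W n h ω}
      ≤ P {ω | ENNReal.ofReal (Real.exp (l * ε - l ^ 2 * V)) ≤ Z ω} := measure_mono hsub
    _ = ENNReal.ofReal (Real.exp (-l * ε + l ^ 2 * V)) *
        (ENNReal.ofReal (Real.exp (l * ε - l ^ 2 * V)) *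
          P {ω | ENNReal.ofReal (Real.exp (l * ε - l ^ 2 * V)) ≤ Z ω}) := by
        rw [← mul_assoc, ← ENNReal.ofReal_mul (Real.exp_pos _).le, ← Real.exp_add]
        rw [show -l * ε + l ^ 2 * V + (l * ε - l ^ 2 * V) = 0 by ring]
        simp
    _ ≤ _ := mul_le_of_le_one_right' (h2.trans h1)

/-- Exponential inequality for centered sums of bounded functions. -/
theorem AdaptedArray.measure_abs_ge_le (H : AdaptedArray P ν η W A n)
    {h : (ℝ × ℝ) × ℝ → ℝ} (hh : Measurable h) {c l V ε : ℝ} (hc : ∀ p, |h p| ≤ c) (hl : 0 ≤ l)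
    (hlc : 2 * l * c ≤ 1) (hV : ∀ ω, ∑ t ∈ Finset.Icc 1 n, ∫ y, h (W t ω, y) ^ 2 ∂ν ≤ V) :
    P {ω | ε ≤ |centeredSum ν η W n h ω|} ≤
      ENNReal.ofReal (2 * Real.exp (-l * ε + l ^ 2 * V)) := by
  have h1 := H.measure_ge_le hh (ε := ε) hc hl hlc hV
  have h2 := H.measure_ge_le hh.neg (ε := ε) (fun p => by simpa using hc p) hl hlc
    (fun ω => by simpa using hV ω)
  rw [two_mul, ENNReal.ofReal_add (Real.exp_pos _).le (Real.exp_pos _).le]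
  refine (measure_mono fun ω hω => ?_).trans ((measure_union_le _ _).trans (add_le_add h1 h2))
  rcases le_abs.1 (show ε ≤ |centeredSum ν η W n h ω| from hω) with hp | hp
  · exact Or.inl hp
  · right
    change ε ≤ centeredSum ν η W n (fun p => -h p) ω
    rwa [centeredSum_neg]

end

/-! ### Compactification of the index set and the Hölder bound for the error law. -/

/-- An increasing homeomorphism of `ℝ` onto `(0, 1)`. -/
noncomputable def squash (y : ℝ) : ℝ := (1 + y / (1 + |y|)) / 2

theorem measurable_squash : Measurable squash := by
  unfold squash
  fun_prop

theorem squash_pos (y : ℝ) : 0 < squash y := by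
  unfold squash
  have h : 0 < 1 + |y| := by positivity
  have : -1 < y / (1 + |y|) := by
    rw [lt_div_iff₀ h]; linarith [neg_abs_le y]
  linarith

theorem squash_lt_one (y : ℝ) : squash y < 1 := by
  unfold squash
  have h : 0 < 1 + |y| := by positivity
  have : y / (1 + |y|) < 1 := by
    rw [div_lt_one h]; linarith [le_abs_self y]
  linarith

theorem sub_le_mul_squash_sub {a b : ℝ} (h : a ≤ b) :
    b - a ≤ 2 * (1 + |a|) * (1 + |b|) * (squash b - squash a) := by
  unfold squash
  have ha : 0 < 1 + |a| := by positivity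
  have hb : 0 < 1 + |b| := by positivity
  have : 2 * (1 + |a|) * (1 + |b|) * ((1 + b / (1 + |b|)) / 2 - (1 + a / (1 + |a|)) / 2)
      = b * (1 + |a|) - a * (1 + |b|) := by
    field_simp
    ring
  rw [this]
  rcases abs_cases a with ⟨h1, h2⟩ | ⟨h1, h2⟩ <;> rcases abs_cases b with ⟨h3, h4⟩ | ⟨h3, h4⟩ <;>
    rw [h1, h3] <;> nlinarith

theorem squash_strictMono : StrictMono squash := by
  intro a b h
  have h1 := sub_le_mul_squash_sub h.le
  have h2 : 0 < 2 * (1 + |a|) * (1 + |b|) := by positivity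
  by_contra hc
  nlinarith

theorem abs_sub_le_mul_abs_squash_sub (a b : ℝ) :
    |a - b| ≤ 2 * (1 + |a|) * (1 + |b|) * |squash a - squash b| := by
  rcases le_total a b with h | h
  · rw [abs_sub_comm, abs_of_nonneg (sub_nonneg.2 h), abs_sub_comm,
      abs_of_nonneg (sub_nonneg.2 (squash_strictMono.monotone h))]
    exact sub_le_mul_squash_sub h
  · rw [abs_of_nonneg (sub_nonneg.2 h), abs_of_nonneg (sub_nonneg.2 (squash_strictMono.monotone h))]
    linarith [sub_le_mul_squash_sub h]

/-- The derivative of `squash` decays like `1 / z²`, so a dilation, which moves `z` by `|z| |d|`,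
moves its image by at most `|d|` uniformly on the line. -/
theorem abs_squash_div_sub_le {d : ℝ} (hd : |d| ≤ 1 / 2) (y : ℝ) :
    |squash (y / (1 + d)) - squash y| ≤ |d| := by
  have hd' := abs_le.1 hd
  have h1 : 0 < 1 + d := by linarith
  obtain ⟨z, rfl⟩ : ∃ z, y = z * (1 + d) := ⟨y / (1 + d), by field_simp⟩
  rw [mul_div_cancel_right₀ _ h1.ne']
  unfold squash
  rw [abs_mul, abs_of_pos h1]
  have hz := abs_nonneg z
  have hA : 0 < 1 + |z| := by positivity
  have hB : 0 < 1 + |z| * (1 + d) := by positivity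
  have : (1 + z / (1 + |z|)) / 2 - (1 + z * (1 + d) / (1 + |z| * (1 + d))) / 2
      = -d * (z / (2 * (1 + |z|) * (1 + |z| * (1 + d)))) := by
    field_simp
    ring
  rw [this, abs_mul, abs_neg]
  refine mul_le_of_le_one_right (abs_nonneg d) ?_
  rw [abs_div, abs_of_pos (by positivity : 0 < 2 * (1 + |z|) * (1 + |z| * (1 + d))),
    div_le_one (by positivity)]
  nlinarith [mul_nonneg hz (mul_nonneg hz h1.le), mul_nonneg hz h1.le]

/-- Moves the perturbation from the threshold to the error, so that all summands share the threshold
`squash x`. -/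
theorem lt_mul_iff_squash_lt {d : ℝ} (hd : |d| ≤ 1 / 2) (x y : ℝ) :
    y < x + x * d ↔ squash (y / (1 + d)) < squash x := by
  have h1 : 0 < 1 + d := by linarith [(abs_le.1 hd).1]
  rw [squash_strictMono.lt_iff_lt, div_lt_iff₀ h1, mul_add, mul_one]

/-- The properties of the error law used in the proof: a moment of order `2 + κ`, and Hölder
continuity of the second moment of the pieces of the line, uniformly in the scale. -/
structure TameLaw (ν : Measure ℝ) (κ M C β : ℝ) : Prop where
  kappa_pos : 0 < κ
  beta_pos : 0 < β
  beta_le : β ≤ 1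
  const_nonneg : 0 ≤ C
  integrable : Integrable (fun y : ℝ => |y| ^ (2 + κ)) ν
  moment_le : ∫ y, |y| ^ (2 + κ) ∂ν ≤ M
  integral_sq_le : ∀ d u w : ℝ, |d| ≤ 1 / 2 → 0 < w → w ≤ 1 → ∀ I ⊆ Set.Icc u (u + w),
    ∫ y, y ^ 2 * I.indicator 1 (squash (y / (1 + d))) ∂ν ≤ C * w ^ β

theorem integral_withDensity_ofReal {g : ℝ → ℝ} (hg : Measurable g) (h0 : ∀ x, 0 ≤ g x)
    (f : ℝ → ℝ) : ∫ y, f y ∂(volume.withDensity fun x => ENNReal.ofReal (g x))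
      = ∫ y, f y * g y := by
  rw [integral_withDensity_eq_integral_toReal_smul (by fun_prop) (by simp)]
  refine integral_congr_ae (ae_of_all _ fun y => ?_)
  simp [ENNReal.toReal_ofReal (h0 y), mul_comm]

theorem integrable_withDensity_ofReal {g : ℝ → ℝ} (hg : Measurable g) (h0 : ∀ x, 0 ≤ g x)
    {f : ℝ → ℝ} : Integrable f (volume.withDensity fun x => ENNReal.ofReal (g x))
      ↔ Integrable fun y => f y * g y := by
  rw [integrable_withDensity_iff (by fun_prop) (by simp)]
  simp [ENNReal.toReal_ofReal (h0 _)]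

/-- On `|y| ≤ R` the inverse of `squash` is Lipschitz with constant of order `R²`. The points `y /
(1 + d)` satisfy `1 + |·| ≤ 3R`, giving `2 · 3R · 3R = 18 R²`, and undoing the division costs a
factor `1 + d ≤ 3/2`. -/
theorem exists_closedBall_of_squash {d u w R : ℝ} (hd : |d| ≤ 1 / 2) (hR : 1 ≤ R) :
    ∃ y₀, ∀ y, |y| ≤ R → squash (y / (1 + d)) ∈ Set.Icc u (u + w) →
      |y - y₀| ≤ 27 * R ^ 2 * w := by
  have hd' := abs_le.1 hd
  have h1 : 0 < 1 + d := by linarith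
  by_cases hex : ∃ y, |y| ≤ R ∧ squash (y / (1 + d)) ∈ Set.Icc u (u + w)
  · obtain ⟨y₀, hy₀, hu₀⟩ := hex
    refine ⟨y₀, fun y hy hu => ?_⟩
    have hz : ∀ y : ℝ, |y| ≤ R → 1 + |y / (1 + d)| ≤ 3 * R := fun y hy => by
      rw [abs_div, abs_of_pos h1]
      have : |y| / (1 + d) ≤ 2 * R := by
        rw [div_le_iff₀ h1]; nlinarith
      linarith
    have h2 := abs_sub_le_mul_abs_squash_sub (y / (1 + d)) (y₀ / (1 + d))
    have h3 : |squash (y / (1 + d)) - squash (y₀ / (1 + d))| ≤ w := by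
      rw [abs_le]; constructor <;> linarith [hu.1, hu.2, hu₀.1, hu₀.2]
    have h4 : |y / (1 + d) - y₀ / (1 + d)| ≤ 2 * (3 * R) * (3 * R) * w := by
      refine h2.trans ?_
      have := hz y hy
      have := hz y₀ hy₀
      gcongr
    rw [← sub_div, abs_div, abs_of_pos h1, div_le_iff₀ h1] at h4
    have h5 : 0 ≤ 2 * (3 * R) * (3 * R) * w := by
      have : 0 ≤ w := (abs_nonneg _).trans h3
      positivity
    nlinarith
  · exact ⟨0, fun y hy hu => (hex ⟨y, hy, hu⟩).elim⟩

theorem exists_tameLaw {g : ℝ → ℝ} (hg : IsCenteredPosDensity g) (hA : AssumptionA1 g) :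
    ∃ κ M C β, TameLaw (volume.withDensity fun x => ENNReal.ofReal (g x)) κ M C β := by
  obtain ⟨B, hB⟩ := hA.bounded
  obtain ⟨κ, hκ, hint⟩ := hA.moment
  have hB0 : 0 ≤ B := le_trans (by simp) (hB 0)
  have h0 := fun x => (hg.pos x).le
  set M := ∫ y, |y| ^ (2 + κ) * g y with hM
  have hM0 : 0 ≤ M := integral_nonneg fun y => mul_nonneg (by positivity) (h0 y)
  refine ⟨κ, M, 54 * B + M, min (1 / 2) (κ / 4), hκ, by positivity,
    (min_le_left _ _).trans (by norm_num), by positivity,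
    (integrable_withDensity_ofReal hg.measurable h0).2 hint,
    (integral_withDensity_ofReal hg.measurable h0 _).le, ?_⟩
  intro d u w hd hw hw1 I hI
  rw [integral_withDensity_ofReal hg.measurable h0]
  -- For `|y| ≤ R` the integrand is at most `B` on a set of length at most `54 R² w = 54 w^{1/2}`;
  -- for `|y| > R` the moment bound gives `R^{-κ} M = w^{κ/4} M`. The exponent `β` is the smaller of
  -- `1/2` and `κ/4`.
  set R : ℝ := w ^ (-(1 / 4) : ℝ) with hR
  have hR1 : 1 ≤ R := Real.one_le_rpow_of_pos_of_le_one_of_nonpos hw hw1 (by norm_num)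
  obtain ⟨y₀, hy₀⟩ := exists_closedBall_of_squash (d := d) (u := u) (w := w) hd hR1
  have hpt : ∀ y, y ^ 2 * I.indicator 1 (squash (y / (1 + d))) * g y ≤
      (Metric.closedBall y₀ (27 * R ^ 2 * w)).indicator (fun _ => B) y
        + R ^ (-κ) * (|y| ^ (2 + κ) * g y) := by
    intro y
    have hA1 : 0 ≤ (Metric.closedBall y₀ (27 * R ^ 2 * w)).indicator (fun _ => B) y :=
      Set.indicator_nonneg (fun _ _ => hB0) y
    have hA2 : 0 ≤ R ^ (-κ) * (|y| ^ (2 + κ) * g y) := by have := h0 y; positivity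
    by_cases hy : squash (y / (1 + d)) ∈ I
    · rw [Set.indicator_of_mem hy, Pi.one_apply, mul_one]
      by_cases hyR : |y| ≤ R
      · have : y ∈ Metric.closedBall y₀ (27 * R ^ 2 * w) := by
          rw [Metric.mem_closedBall, Real.dist_eq]
          exact hy₀ y hyR (hI hy)
        rw [Set.indicator_of_mem this]
        linarith [hB y]
      · push Not at hyR
        have hy0 : 0 < |y| := by linarith
        have : y ^ 2 * g y ≤ R ^ (-κ) * (|y| ^ (2 + κ) * g y) := by
          rw [Real.rpow_add hy0, ← mul_assoc]
          refine mul_le_mul_of_nonneg_right ?_ (h0 y)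
          rw [Real.rpow_two, sq_abs, Real.rpow_neg (by linarith)]
          have : R ^ κ ≤ |y| ^ κ := Real.rpow_le_rpow (by linarith) hyR.le hκ.le
          have hRk : 0 < R ^ κ := Real.rpow_pos_of_pos (by linarith) _
          rw [inv_mul_eq_div, le_div_iff₀ hRk]
          exact mul_le_mul_of_nonneg_left this (sq_nonneg y)
        linarith
    · rw [Set.indicator_of_notMem hy]
      simp only [mul_zero, zero_mul]
      linarith
  have hi1 : Integrable ((Metric.closedBall y₀ (27 * R ^ 2 * w)).indicator fun _ => B) :=
    (integrable_indicator_iff Metric.isClosed_closedBall.measurableSet).2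
      (integrableOn_const (measure_closedBall_lt_top).ne)
  have hi2 : Integrable fun y => R ^ (-κ) * (|y| ^ (2 + κ) * g y) := hint.const_mul _
  have hmono := integral_mono_of_nonneg (μ := volume)
    (f := fun y => y ^ 2 * I.indicator 1 (squash (y / (1 + d))) * g y)
    (ae_of_all _ fun y => mul_nonneg (mul_nonneg (sq_nonneg y)
      (Set.indicator_nonneg (fun _ _ => by simp) _)) (h0 y))
    (hi1.add hi2) (ae_of_all _ hpt)
  refine hmono.trans ?_
  simp only [Pi.add_apply]
  rw [integral_add hi1 hi2, integral_const_mul, ← hM,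
    integral_indicator Metric.isClosed_closedBall.measurableSet, setIntegral_const, Measure.real,
    Real.volume_closedBall, ENNReal.toReal_ofReal (by positivity), smul_eq_mul]
  have e1 : R ^ 2 * w = w ^ (1 / 2 : ℝ) := by
    rw [hR, ← Real.rpow_natCast, ← Real.rpow_mul hw.le]
    nth_rewrite 2 [← Real.rpow_one w]
    rw [← Real.rpow_add hw]
    norm_num
  have e2 : R ^ (-κ) = w ^ (κ / 4) := by
    rw [hR, ← Real.rpow_mul hw.le]
    ring_nf
  have m1 : w ^ (1 / 2 : ℝ) ≤ w ^ min (1 / 2) (κ / 4) :=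
    Real.rpow_le_rpow_of_exponent_ge hw hw1 (min_le_left _ _)
  have m2 : w ^ (κ / 4) ≤ w ^ min (1 / 2) (κ / 4) :=
    Real.rpow_le_rpow_of_exponent_ge hw hw1 (min_le_right _ _)
  rw [e2]
  calc 2 * (27 * R ^ 2 * w) * B + w ^ (κ / 4) * M
      = 54 * B * w ^ (1 / 2 : ℝ) + M * w ^ (κ / 4) := by rw [← e1]; ring
    _ ≤ 54 * B * w ^ min (1 / 2) (κ / 4) + M * w ^ min (1 / 2) (κ / 4) := by gcongr
    _ = _ := by ring

/-! ### Truncated summands restricted to a range of the index. -/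

/-- Truncation at level `c`. -/
noncomputable def trunc (c x : ℝ) : ℝ := if |x| ≤ c then x else 0

theorem measurable_trunc (c : ℝ) : Measurable (trunc c) :=
  Measurable.ite (measurableSet_le (by fun_prop) measurable_const) measurable_id measurable_const

theorem abs_trunc_le {c : ℝ} (hc : 0 ≤ c) (x : ℝ) : |trunc c x| ≤ c := by
  unfold trunc
  split_ifs with h
  · exact h
  · simpa using hc

theorem abs_trunc_le_abs (c x : ℝ) : |trunc c x| ≤ |x| := by
  unfold trunc
  split_ifs with h
  · exact le_rfl
  · simp

/-- The part of the truncated summand `z y` with `squash (y / (1 + d)) ∈ I`. -/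
noncomputable def piece (c : ℝ) (I : Set ℝ) (p : (ℝ × ℝ) × ℝ) : ℝ :=
  trunc c (p.1.1 * p.2) * I.indicator 1 (squash (p.2 / (1 + p.1.2)))

theorem measurable_piece (c : ℝ) {I : Set ℝ} (hI : MeasurableSet I) :
    Measurable (piece c I) :=
  ((measurable_trunc c).comp (by fun_prop)).mul
    ((measurable_one.indicator hI).comp (measurable_squash.comp (by fun_prop)))

theorem abs_piece (c : ℝ) (I : Set ℝ) (p : (ℝ × ℝ) × ℝ) :
    |piece c I p| = |trunc c (p.1.1 * p.2)| * I.indicator 1 (squash (p.2 / (1 + p.1.2))) := by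
  rw [piece, abs_mul, abs_of_nonneg (a := I.indicator 1 _)
    (Set.indicator_nonneg (fun _ _ => by simp) _)]

theorem indicator_one_le_one (I : Set ℝ) (x : ℝ) : I.indicator (1 : ℝ → ℝ) x ≤ 1 :=
  Set.indicator_apply_le' (fun _ => le_rfl) (fun _ => zero_le_one)

theorem indicator_one_nonneg (I : Set ℝ) (x : ℝ) : 0 ≤ I.indicator (1 : ℝ → ℝ) x :=
  Set.indicator_nonneg (fun _ _ => by simp) _

theorem abs_piece_le {c : ℝ} (hc : 0 ≤ c) (I : Set ℝ) (p : (ℝ × ℝ) × ℝ) : |piece c I p| ≤ c := by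
  rw [abs_piece]
  exact (mul_le_of_le_one_right (abs_nonneg _) (indicator_one_le_one _ _)).trans
    (abs_trunc_le hc _)

theorem abs_piece_mono (c : ℝ) {I J : Set ℝ} (h : I ⊆ J) (p : (ℝ × ℝ) × ℝ) :
    |piece c I p| ≤ |piece c J p| := by
  rw [abs_piece, abs_piece]
  exact mul_le_mul_of_nonneg_left
    (Set.indicator_le_indicator_of_subset h (fun _ => by simp) _) (abs_nonneg _)

theorem piece_add_diff (c : ℝ) {V U : Set ℝ} (h : V ⊆ U) (p : (ℝ × ℝ) × ℝ) :
    piece c U p = piece c V p + piece c (U \ V) p := by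
  unfold piece
  rw [← mul_add]
  congr 1
  have := congrFun (Set.indicator_union_of_disjoint (s := V) (t := U \ V)
    Set.disjoint_sdiff_right (1 : ℝ → ℝ)) (squash (p.2 / (1 + p.1.2)))
  rwa [Set.union_sdiff_cancel h] at this

theorem integrable_of_abs_le {ν : Measure ℝ} [IsProbabilityMeasure ν] {f : ℝ → ℝ}
    (hf : Measurable f) {c : ℝ} (h : ∀ y, |f y| ≤ c) : Integrable f ν :=
  Integrable.of_bound hf.aestronglyMeasurable c (ae_of_all _ h)

theorem integrable_piece {ν : Measure ℝ} [IsProbabilityMeasure ν] {c : ℝ} (hc : 0 ≤ c)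
    {I : Set ℝ} (hI : MeasurableSet I) (w : ℝ × ℝ) : Integrable (fun y => piece c I (w, y)) ν :=
  integrable_of_abs_le ((measurable_piece c hI).comp measurable_prodMk_left)
    fun _ => abs_piece_le hc _ _

theorem TameLaw.integrable_sq {ν : Measure ℝ} [IsProbabilityMeasure ν] {κ M C β : ℝ}
    (T : TameLaw ν κ M C β) : Integrable (fun y : ℝ => y ^ 2) ν := by
  refine Integrable.mono' (T.integrable.add (integrable_const 1))
    (by fun_prop) (ae_of_all _ fun y => ?_)
  have hκ := T.kappa_pos
  rw [Real.norm_eq_abs, abs_pow, Pi.add_apply]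
  rcases le_total |y| 1 with h | h
  · have : 0 ≤ |y| ^ (2 + κ) := by positivity
    nlinarith [abs_nonneg y]
  · have := Real.rpow_le_rpow_of_exponent_le h (by linarith : (2 : ℝ) ≤ 2 + κ)
    rw [Real.rpow_two] at this
    linarith

theorem TameLaw.integrable_id {ν : Measure ℝ} [IsProbabilityMeasure ν] {κ M C β : ℝ}
    (T : TameLaw ν κ M C β) : Integrable (fun y : ℝ => y) ν := by
  refine Integrable.mono' (T.integrable_sq.add (integrable_const 1))
    (by fun_prop) (ae_of_all _ fun y => ?_)
  rw [Real.norm_eq_abs, Pi.add_apply]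
  nlinarith [sq_nonneg (|y| - 1), sq_abs y, abs_nonneg y]

theorem TameLaw.integrable_sq_mul_indicator {ν : Measure ℝ} [IsProbabilityMeasure ν]
    {κ M C β : ℝ} (T : TameLaw ν κ M C β) {I : Set ℝ} (hI : MeasurableSet I) (d : ℝ) :
    Integrable (fun y => y ^ 2 * I.indicator (1 : ℝ → ℝ) (squash (y / (1 + d)))) ν := by
  have hm : Measurable fun y : ℝ => squash (y / (1 + d)) := measurable_squash.comp (by fun_prop)
  refine T.integrable_sq.mono' ((by fun_prop : Measurable fun y : ℝ => y ^ 2).mul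
    ((measurable_one.indicator hI).comp hm)).aestronglyMeasurable (ae_of_all _ fun y => ?_)
  rw [Real.norm_of_nonneg (mul_nonneg (sq_nonneg y) (indicator_one_nonneg _ _))]
  exact mul_le_of_le_one_right (sq_nonneg y) (indicator_one_le_one _ _)

/-! ### Deviation bounds on dyadic cells and the chaining sum. -/

section

variable {Ω : Type*} [mΩ : MeasurableSpace Ω] {P : Measure Ω} [IsProbabilityMeasure P]
  {ν : Measure ℝ} [IsProbabilityMeasure ν] {η : ℕ → Ω → ℝ} {W : ℕ → Ω → ℝ × ℝ}
  {A : ℕ → MeasurableSpace Ω} {n : ℕ} {κ M C β K c : ℝ}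

/-- The exponential inequality with the variance supplied by the Hölder bound. The scale `e` that
locates the error is separate from the perturbation in `W`: it is `(W t ω).2` for cells and `0` when
perturbed and unperturbed summands are compared. -/
theorem TameLaw.measure_abs_ge_le (T : TameLaw ν κ M C β) (H : AdaptedArray P ν η W A n)
    (hK : ∀ ω, ∑ t ∈ Finset.Icc 1 n, (W t ω).1 ^ 2 ≤ K)
    {h : (ℝ × ℝ) × ℝ → ℝ} (hh : Measurable h) (hc : ∀ p, |h p| ≤ c) {u w : ℝ} (hw : 0 < w)
    (hw1 : w ≤ 1) {I : Set ℝ} (hI : MeasurableSet I) (hIu : I ⊆ Set.Icc u (u + w))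
    {e : ℕ → Ω → ℝ} (he : ∀ t ω, |e t ω| ≤ 1 / 2)
    (hb : ∀ t ω y, |h (W t ω, y)| ≤
      |(W t ω).1 * y| * I.indicator 1 (squash (y / (1 + e t ω)))) {l ε : ℝ} (hl : 0 ≤ l)
    (hlc : 2 * l * c ≤ 1) :
    P {ω | ε ≤ |centeredSum ν η W n h ω|} ≤
      ENNReal.ofReal (2 * Real.exp (-l * ε + l ^ 2 * (K * (C * w ^ β)))) := by
  refine H.measure_abs_ge_le hh hc hl hlc fun ω => ?_
  have h0 : 0 ≤ C * w ^ β := mul_nonneg T.const_nonneg (Real.rpow_nonneg hw.le _)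
  calc ∑ t ∈ Finset.Icc 1 n, ∫ y, h (W t ω, y) ^ 2 ∂ν
      ≤ ∑ t ∈ Finset.Icc 1 n, (W t ω).1 ^ 2 * (C * w ^ β) := by
        refine Finset.sum_le_sum fun t _ => ?_
        refine le_trans ?_ (mul_le_mul_of_nonneg_left
          (T.integral_sq_le (e t ω) u w (he t ω) hw hw1 I hIu) (sq_nonneg _))
        rw [← integral_const_mul]
        refine integral_mono_of_nonneg (ae_of_all _ fun y => sq_nonneg _)
          ((T.integrable_sq_mul_indicator hI _).const_mul _) (ae_of_all _ fun y => ?_)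
        have h1 := pow_le_pow_left₀ (abs_nonneg _) (hb t ω y) 2
        have h2 := indicator_one_le_one I (squash (y / (1 + e t ω)))
        have h3 := indicator_one_nonneg I (squash (y / (1 + e t ω)))
        rw [sq_abs, mul_pow, sq_abs, mul_pow] at h1
        refine h1.trans ?_
        have : (I.indicator (1 : ℝ → ℝ) (squash (y / (1 + e t ω)))) ^ 2
            ≤ I.indicator 1 (squash (y / (1 + e t ω))) := by nlinarith
        calc _ ≤ (W t ω).1 ^ 2 * y ^ 2 * I.indicator 1 (squash (y / (1 + e t ω))) := by gcongr
          _ = _ := by ring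
    _ = (∑ t ∈ Finset.Icc 1 n, (W t ω).1 ^ 2) * (C * w ^ β) := by rw [Finset.sum_mul]
    _ ≤ K * (C * w ^ β) := mul_le_mul_of_nonneg_right (hK ω) h0

/-- The dyadic cell `[j 2^{-k}, (j + 1) 2^{-k})`. -/
def cell (k j : ℕ) : Set ℝ := Set.Ico ((j : ℝ) / 2 ^ k) ((j + 1 : ℝ) / 2 ^ k)

/-- Bound for the probability of a large centered sum over one of the cells of level `k`. -/
noncomputable def chainTerm (K C ε s : ℝ) (k : ℕ) : ℝ≥0∞ :=
  2 ^ k * ENNReal.ofReal (2 * Real.exp (-ε * s ^ k + K * C))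

/-- With `l = s^{2k}` the threshold `ε s^{-k}` contributes `-ε s^k` to the exponent, while `s⁴ ≤
2^β` keeps the variance term at most `K C`. The generic `h` covers both `piece` and its absolute
value, the latter being needed at the finest level. -/
theorem TameLaw.measure_exists_cell_le (T : TameLaw ν κ M C β) (H : AdaptedArray P ν η W A n)
    (hK : ∀ ω, ∑ t ∈ Finset.Icc 1 n, (W t ω).1 ^ 2 ≤ K) (hK0 : 0 ≤ K)
    (hd : ∀ t ω, |(W t ω).2| ≤ 1 / 2)
    {h : Set ℝ → (ℝ × ℝ) × ℝ → ℝ} (hh : ∀ I, MeasurableSet I → Measurable (h I))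
    (hhp : ∀ I p, |h I p| ≤ |piece c I p|) (hc : 0 ≤ c) {s ε : ℝ} (hs : 1 ≤ s)
    (hsβ : s ^ 4 ≤ 2 ^ β) {k : ℕ} (hk : 2 * s ^ (2 * k) * c ≤ 1) :
    P {ω | ∃ j < 2 ^ k, ε * s⁻¹ ^ k ≤ |centeredSum ν η W n (h (cell k j)) ω|} ≤
      chainTerm K C ε s k := by
  have hs0 : 0 < s := by linarith
  have hw : (0 : ℝ) < ((2 : ℝ) ^ k)⁻¹ := by positivity
  have hcell : ∀ j : ℕ, P {ω | ε * s⁻¹ ^ k ≤ |centeredSum ν η W n (h (cell k j)) ω|} ≤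
      ENNReal.ofReal (2 * Real.exp (-ε * s ^ k + K * C)) := by
    intro j
    refine (T.measure_abs_ge_le H hK (hh _ measurableSet_Ico)
      (fun p => (hhp _ p).trans (abs_piece_le hc _ _)) (u := j / 2 ^ k) hw
      (inv_le_one_of_one_le₀ (one_le_pow₀ (by norm_num))) (I := cell k j) measurableSet_Ico
      (fun x hx => ⟨hx.1, hx.2.le.trans_eq (by ring)⟩) (e := fun t ω => (W t ω).2) hd
      (fun t ω y => ?_) (l := s ^ (2 * k)) (by positivity) hk).trans ?_
    · refine (hhp _ _).trans ?_
      rw [abs_piece]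
      exact mul_le_mul_of_nonneg_right (abs_trunc_le_abs _ _) (indicator_one_nonneg _ _)
    · refine ENNReal.ofReal_le_ofReal (mul_le_mul_of_nonneg_left (Real.exp_le_exp.2 ?_) (by simp))
      have e1 : -s ^ (2 * k) * (ε * s⁻¹ ^ k) = -ε * s ^ k := by
        rw [two_mul, pow_add, inv_pow]; field_simp
      have e2 : (s ^ (2 * k)) ^ 2 * (((2 : ℝ) ^ k)⁻¹) ^ β ≤ 1 := by
        rw [Real.inv_rpow (by positivity), ← Real.rpow_natCast 2 k, ← Real.rpow_mul (by simp),
          mul_comm (k : ℝ), Real.rpow_mul (by simp), Real.rpow_natCast, ← div_eq_mul_inv,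
          div_le_one (by positivity), ← pow_mul, show 2 * k * 2 = 4 * k by ring, pow_mul]
        exact pow_le_pow_left₀ (by positivity) hsβ k
      rw [e1]
      have := mul_le_mul_of_nonneg_left e2 (mul_nonneg hK0 T.const_nonneg)
      nlinarith
  have hU : {ω | ∃ j < 2 ^ k, ε * s⁻¹ ^ k ≤ |centeredSum ν η W n (h (cell k j)) ω|} ⊆
      ⋃ j ∈ Finset.range (2 ^ k),
        {ω | ε * s⁻¹ ^ k ≤ |centeredSum ν η W n (h (cell k j)) ω|} := by
    rintro ω ⟨j, hj, hω⟩
    simp only [Set.mem_iUnion, Finset.mem_range]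
    exact ⟨j, hj, hω⟩
  refine (measure_mono hU).trans ((measure_biUnion_finset_le _ _).trans ?_)
  refine (Finset.sum_le_sum fun j _ => hcell j).trans_eq ?_
  simp [chainTerm]

/-- Levels stop at `k₁` because the exponential inequality needs `2 l c ≤ 1` with `l = s^{2k}`; the
full series bounds the finite sum uniformly in `k₁`. -/
theorem TameLaw.measure_exists_level_le (T : TameLaw ν κ M C β) (H : AdaptedArray P ν η W A n)
    (hK : ∀ ω, ∑ t ∈ Finset.Icc 1 n, (W t ω).1 ^ 2 ≤ K) (hK0 : 0 ≤ K)
    (hd : ∀ t ω, |(W t ω).2| ≤ 1 / 2)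
    {h : Set ℝ → (ℝ × ℝ) × ℝ → ℝ} (hh : ∀ I, MeasurableSet I → Measurable (h I))
    (hhp : ∀ I p, |h I p| ≤ |piece c I p|) (hc : 0 ≤ c) {s ε : ℝ} (hs : 1 ≤ s)
    (hsβ : s ^ 4 ≤ 2 ^ β) {k₀ k₁ : ℕ} (hk : 2 * s ^ (2 * k₁) * c ≤ 1) :
    P {ω | ∃ k, k₀ ≤ k ∧ k ≤ k₁ ∧
        ∃ j < 2 ^ k, ε * s⁻¹ ^ k ≤ |centeredSum ν η W n (h (cell k j)) ω|} ≤
      ∑' i, chainTerm K C ε s (i + k₀) := by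
  have hU : {ω | ∃ k, k₀ ≤ k ∧ k ≤ k₁ ∧
        ∃ j < 2 ^ k, ε * s⁻¹ ^ k ≤ |centeredSum ν η W n (h (cell k j)) ω|} ⊆
      ⋃ i : ℕ, {ω | i + k₀ ≤ k₁ ∧ ∃ j < 2 ^ (i + k₀),
        ε * s⁻¹ ^ (i + k₀) ≤ |centeredSum ν η W n (h (cell (i + k₀) j)) ω|} := by
    rintro ω ⟨k, h1, h2, hω⟩
    obtain ⟨i, rfl⟩ := Nat.exists_eq_add_of_le' h1
    exact Set.mem_iUnion.2 ⟨i, h2, hω⟩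
  refine (measure_mono hU).trans ((measure_iUnion_le _).trans (ENNReal.tsum_le_tsum fun i => ?_))
  by_cases hi : i + k₀ ≤ k₁
  · refine (measure_mono fun ω hω => hω.2).trans
      (T.measure_exists_cell_le H hK hK0 hd hh hhp hc (ε := ε) hs hsβ (le_trans ?_ hk))
    gcongr
  · simp [hi]

theorem tsum_chainTerm_tendsto (K C : ℝ) {ε s : ℝ} (hε : 0 < ε) (hs : 1 < s) :
    Tendsto (fun k₀ => ∑' i, chainTerm K C ε s (i + k₀)) atTop (𝓝 0) := by
  refine ENNReal.tendsto_sum_nat_add _ ?_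
  have hre : ∀ k, chainTerm K C ε s k
      = ENNReal.ofReal (2 ^ k * (2 * Real.exp (-ε * s ^ k + K * C))) := fun k => by
    rw [chainTerm, ENNReal.ofReal_mul (p := 2 ^ k) (by positivity),
      ENNReal.ofReal_pow (by norm_num), ENNReal.ofReal_ofNat]
  simp only [hre]
  refine Summable.tsum_ofReal_ne_top ?_
  -- As `k / s^k → 0`, eventually `ε s^k ≥ k`, so the terms are dominated by a geometric series of
  -- ratio `2 / e < 1`.
  have hgeo : Summable fun k : ℕ => (2 * Real.exp (K * C)) * (2 * Real.exp (-1)) ^ k := by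
    refine (summable_geometric_of_lt_one (by positivity) ?_).mul_left _
    have := Real.exp_neg_one_lt_half
    linarith
  refine Summable.of_norm_bounded_eventually_nat hgeo ?_
  have ht := tendsto_pow_const_div_const_pow_of_one_lt 1 hs
  filter_upwards [ht.eventually_lt_const hε] with k hk
  have hsk : 0 < s ^ k := by positivity
  rw [pow_one, div_lt_iff₀ hsk] at hk
  rw [Real.norm_of_nonneg (by positivity), Real.exp_add, mul_pow, ← Real.exp_nat_mul]
  have : Real.exp (-ε * s ^ k) ≤ Real.exp (k * -1) := Real.exp_le_exp.2 (by linarith)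
  calc _ = 2 * Real.exp (K * C) * (2 ^ k * Real.exp (-ε * s ^ k)) := by ring
    _ ≤ _ := by gcongr

/-- Chaining along the dyadic points below `u`. -/
theorem abs_chain_le {D : ℝ → ℝ} {e : ℕ → ℝ} {k₀ m : ℕ}
    (h : ∀ k, k₀ ≤ k → k ≤ k₀ + m → ∀ j : ℕ, j < 2 ^ k →
      |D ((j + 1 : ℝ) / 2 ^ k) - D ((j : ℝ) / 2 ^ k)| ≤ e k) (he : ∀ k, 0 ≤ e k)
    {u : ℝ} (hu0 : 0 ≤ u) (hu1 : u < 1) :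
    |D (⌊2 ^ (k₀ + m) * u⌋₊ / 2 ^ (k₀ + m)) - D (⌊2 ^ k₀ * u⌋₊ / 2 ^ k₀)| ≤
      ∑ i ∈ Finset.range m, e (k₀ + i + 1) := by
  induction m with
  | zero => simp
  | succ m ih =>
    rw [Finset.sum_range_succ]
    have ih := ih fun k h1 h2 => h k h1 (by omega)
    set k := k₀ + m with hk
    set a := ⌊2 ^ k * u⌋₊ with ha
    have ha1 : (a : ℝ) ≤ 2 ^ k * u := Nat.floor_le (by positivity)
    have ha2 : 2 ^ k * u < a + 1 := Nat.lt_floor_add_one _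
    have hstep : |D (⌊2 ^ (k + 1) * u⌋₊ / 2 ^ (k + 1)) - D (a / 2 ^ k)| ≤ e (k + 1) := by
      have hp : (2 : ℝ) ^ (k + 1) * u = 2 * (2 ^ k * u) := by rw [pow_succ]; ring
      have hdiv : ((2 * a : ℕ) : ℝ) / 2 ^ (k + 1) = a / 2 ^ k := by
        rw [pow_succ]; push_cast; field_simp
      -- Refining the grid turns `a` into `2a` or `2a + 1`. In the first case the dyadic point is
      -- unchanged; in the second it moves across the cell of index `2a` at level `k + 1`.
      by_cases hc : 2 * (2 ^ k * u) < 2 * a + 1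
      · have : ⌊2 ^ (k + 1) * u⌋₊ = 2 * a := by
          rw [Nat.floor_eq_iff (by positivity), hp]
          push_cast
          constructor <;> linarith
        rw [this, hdiv, sub_self, abs_zero]
        exact he _
      · have : ⌊2 ^ (k + 1) * u⌋₊ = 2 * a + 1 := by
          rw [Nat.floor_eq_iff (by positivity), hp]
          push_cast
          constructor <;> linarith
        rw [this, ← hdiv]
        have hlt : 2 * a < 2 ^ (k + 1) := by
          have : (a : ℝ) < 2 ^ k := lt_of_le_of_lt ha1 (mul_lt_of_lt_one_right (by positivity) hu1)
          have : a < 2 ^ k := by exact_mod_cast this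
          rw [pow_succ]; omega
        have := h (k + 1) (by omega) (by omega) (2 * a) hlt
        push_cast at this ⊢
        exact this
    calc _ ≤ |D (⌊2 ^ (k + 1) * u⌋₊ / 2 ^ (k + 1)) - D (a / 2 ^ k)|
          + |D (a / 2 ^ k) - D (⌊2 ^ k₀ * u⌋₊ / 2 ^ k₀)| := abs_sub_le _ _ _
      _ ≤ _ := by linarith

end

/-! ### Oscillation of the centered sums between the coarse grid points. -/

/-- The array of weights with the perturbations set to zero. -/
def unperturbed {Ω : Type*} (W : ℕ → Ω → ℝ × ℝ) : ℕ → Ω → ℝ × ℝ := fun t ω => ((W t ω).1, 0)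

theorem AdaptedArray.unperturbed {Ω : Type*} [mΩ : MeasurableSpace Ω] {P : Measure Ω}
    {ν : Measure ℝ} {η : ℕ → Ω → ℝ} {W : ℕ → Ω → ℝ × ℝ} {A : ℕ → MeasurableSpace Ω} {n : ℕ}
    (H : AdaptedArray P ν η W A n) : AdaptedArray P ν η (unperturbed W) A n where
  sub := H.sub
  meas := H.meas
  law := H.law
  indep := H.indep
  weights t j h1 h2 h3 := (measurable_fst.comp (H.weights t j h1 h2 h3)).prodMk measurable_const
  past := H.past

section

variable {Ω : Type*} {ν : Measure ℝ} [IsProbabilityMeasure ν] {η : ℕ → Ω → ℝ}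
  {W : ℕ → Ω → ℝ × ℝ} {n : ℕ} {κ M C β K c : ℝ}

theorem centeredSum_piece_add_diff (hc : 0 ≤ c) {V U : Set ℝ} (hV : MeasurableSet V)
    (hU : MeasurableSet U) (h : V ⊆ U) (ω : Ω) :
    centeredSum ν η W n (piece c U) ω =
      centeredSum ν η W n (piece c V) ω + centeredSum ν η W n (piece c (U \ V)) ω := by
  simp only [centeredSum, ← Finset.sum_add_distrib]
  refine Finset.sum_congr rfl fun t _ => ?_
  simp only [piece_add_diff c h]
  rw [integral_add (integrable_piece hc hV _) (integrable_piece hc (hU.diff hV) _)]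
  ring

/-- Unlike `piece`, its absolute value is monotone in the set, so a partial cell is controlled by
the whole cell; recentering the sum of absolute values yields the factor 2 on the conditional means.
-/
theorem abs_centeredSum_piece_le (hc : 0 ≤ c) {I J : Set ℝ}
    (hJ : MeasurableSet J) (h : I ⊆ J) (ω : Ω) :
    |centeredSum ν η W n (piece c I) ω| ≤ |centeredSum ν η W n (fun p => |piece c J p|) ω|
      + 2 * ∑ t ∈ Finset.Icc 1 n, ∫ y, |piece c J (W t ω, y)| ∂ν := by
  have h1 : |centeredSum ν η W n (piece c I) ω| ≤ ∑ t ∈ Finset.Icc 1 n,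
      (|piece c J (W t ω, η t ω)| + ∫ y, |piece c J (W t ω, y)| ∂ν) := by
    refine (Finset.abs_sum_le_sum_abs _ _).trans (Finset.sum_le_sum fun t _ => ?_)
    refine (abs_sub _ _).trans (add_le_add (abs_piece_mono c h _) ?_)
    refine (abs_integral_le_integral_abs).trans ?_
    exact integral_mono_of_nonneg (ae_of_all _ fun y => abs_nonneg _)
      (integrable_piece hc hJ _).abs (ae_of_all _ fun y => abs_piece_mono c h _)
  have h2 := le_abs_self (centeredSum ν η W n (fun p => |piece c J p|) ω)
  have h3 : centeredSum ν η W n (fun p => |piece c J p|) ω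
      = ∑ t ∈ Finset.Icc 1 n, |piece c J (W t ω, η t ω)|
        - ∑ t ∈ Finset.Icc 1 n, ∫ y, |piece c J (W t ω, y)| ∂ν := by
    simp only [centeredSum, Finset.sum_sub_distrib]
  rw [Finset.sum_add_distrib] at h1
  linarith

/-- The inequality `|z| ≤ τ + z² / τ` trades first moments for the second moments bounded by the
tame law; `τ` is free to depend on `n`. -/
theorem TameLaw.sum_integral_abs_piece_le (T : TameLaw ν κ M C β)
    (hK : ∀ ω, ∑ t ∈ Finset.Icc 1 n, (W t ω).1 ^ 2 ≤ K) (hd : ∀ t ω, |(W t ω).2| ≤ 1 / 2)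
    {u w τ : ℝ} (hw : 0 < w) (hw1 : w ≤ 1) (hτ : 0 < τ) {I : Set ℝ} (hI : MeasurableSet I)
    (hIu : I ⊆ Set.Icc u (u + w)) (ω : Ω) :
    ∑ t ∈ Finset.Icc 1 n, ∫ y, |piece c I (W t ω, y)| ∂ν ≤ n * τ + K / τ * (C * w ^ β) := by
  have h0 : 0 ≤ C * w ^ β := mul_nonneg T.const_nonneg (Real.rpow_nonneg hw.le _)
  calc ∑ t ∈ Finset.Icc 1 n, ∫ y, |piece c I (W t ω, y)| ∂ν
      ≤ ∑ t ∈ Finset.Icc 1 n, (τ + (W t ω).1 ^ 2 / τ * (C * w ^ β)) := by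
        refine Finset.sum_le_sum fun t _ => ?_
        have hi := (T.integrable_sq_mul_indicator hI (W t ω).2).const_mul ((W t ω).1 ^ 2 / τ)
        have h1 : ∫ y, |piece c I (W t ω, y)| ∂ν ≤ ∫ y, (τ + (W t ω).1 ^ 2 / τ *
            (y ^ 2 * I.indicator (1 : ℝ → ℝ) (squash (y / (1 + (W t ω).2))))) ∂ν := by
          refine integral_mono_of_nonneg (ae_of_all _ fun y => abs_nonneg _)
            ((integrable_const τ).add hi) (ae_of_all _ fun y => ?_)
          simp only [abs_piece]
          have h2 := abs_trunc_le_abs c ((W t ω).1 * y)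
          have h3 := indicator_one_nonneg I (squash (y / (1 + (W t ω).2)))
          have h4 := indicator_one_le_one I (squash (y / (1 + (W t ω).2)))
          have h5 : |(W t ω).1 * y| ≤ τ + ((W t ω).1 * y) ^ 2 / τ := by
            rw [← sub_le_iff_le_add', le_div_iff₀ hτ]
            nlinarith [sq_abs ((W t ω).1 * y), sq_nonneg (|(W t ω).1 * y| - τ)]
          calc _ ≤ (τ + ((W t ω).1 * y) ^ 2 / τ)
                * I.indicator 1 (squash (y / (1 + (W t ω).2))) := by
                gcongr
                exact h2.trans h5
            _ = τ * I.indicator 1 (squash (y / (1 + (W t ω).2))) + (W t ω).1 ^ 2 / τ *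
                (y ^ 2 * I.indicator 1 (squash (y / (1 + (W t ω).2)))) := by ring
            _ ≤ _ := by gcongr; exact mul_le_of_le_one_right hτ.le h4
        refine h1.trans ?_
        rw [integral_add (integrable_const τ) hi, integral_const, integral_const_mul]
        simp only [probReal_univ, one_smul]
        gcongr
        exact T.integral_sq_le _ u w (hd t ω) hw hw1 I hIu
    _ = n * τ + (∑ t ∈ Finset.Icc 1 n, (W t ω).1 ^ 2) / τ * (C * w ^ β) := by
        rw [Finset.sum_add_distrib, ← Finset.sum_mul, ← Finset.sum_div]; simp
    _ ≤ _ := by have := hK ω; gcongr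

theorem TameLaw.sum_integral_abs_piece_cell_le (T : TameLaw ν κ M C β)
    (hK : ∀ ω, ∑ t ∈ Finset.Icc 1 n, (W t ω).1 ^ 2 ≤ K) (hd : ∀ t ω, |(W t ω).2| ≤ 1 / 2)
    {τ : ℝ} (hτ : 0 < τ) (k j : ℕ) (ω : Ω) :
    ∑ t ∈ Finset.Icc 1 n, ∫ y, |piece c (cell k j) (W t ω, y)| ∂ν ≤
      n * τ + K / τ * (C * ((2 : ℝ) ^ k)⁻¹ ^ β) :=
  T.sum_integral_abs_piece_le hK hd (u := j / 2 ^ k) (by positivity)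
    (inv_le_one_of_one_le₀ (one_le_pow₀ (by norm_num))) hτ measurableSet_Ico
    (fun x hx => ⟨hx.1, hx.2.le.trans_eq (by ring)⟩) ω

/-- Allowing any `U` between `Iio u` and `Iic u` treats the strict inequality in `Vtilde` and the
weak one in `Vstar` together. -/
theorem abs_centeredSum_sub_floor_le (hc : 0 ≤ c) {s ε E : ℝ} (hs : 1 < s) (hε : 0 ≤ ε)
    {k₀ k₁ : ℕ} (hk : k₀ ≤ k₁) {ω : Ω}
    (h1 : ∀ k, k₀ ≤ k → k ≤ k₁ → ∀ j < 2 ^ k,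
      |centeredSum ν η W n (piece c (cell k j)) ω| ≤ ε * s⁻¹ ^ k)
    (h2 : ∀ j < 2 ^ k₁, |centeredSum ν η W n (fun p => |piece c (cell k₁ j) p|) ω| ≤ ε)
    (h3 : ∀ j, ∑ t ∈ Finset.Icc 1 n, ∫ y, |piece c (cell k₁ j) (W t ω, y)| ∂ν ≤ E)
    {u : ℝ} (hu0 : 0 ≤ u) (hu1 : u < 1) {U : Set ℝ} (hU : MeasurableSet U)
    (hU1 : Set.Iio u ⊆ U) (hU2 : U ⊆ Set.Iic u) :
    |centeredSum ν η W n (piece c U) ω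
      - centeredSum ν η W n (piece c (Set.Iio (⌊2 ^ k₀ * u⌋₊ / 2 ^ k₀))) ω| ≤
        ε / (1 - s⁻¹) + ε + 2 * E := by
  obtain ⟨m, rfl⟩ := Nat.exists_eq_add_of_le hk
  have hs0 : 0 < s := by linarith
  have hsi : 0 < s⁻¹ := by positivity
  have hs1 : s⁻¹ < 1 := inv_lt_one_of_one_lt₀ hs
  set D : ℝ → ℝ := fun v => centeredSum ν η W n (piece c (Set.Iio v)) ω with hD
  have hchain : |D (⌊2 ^ (k₀ + m) * u⌋₊ / 2 ^ (k₀ + m)) - D (⌊2 ^ k₀ * u⌋₊ / 2 ^ k₀)| ≤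
      ∑ i ∈ Finset.range m, ε * s⁻¹ ^ (k₀ + i + 1) := by
    refine abs_chain_le (e := fun k => ε * s⁻¹ ^ k) (fun k hk1 hk2 j hj => ?_)
      (fun k => by positivity) hu0 hu1
    have hle : (j : ℝ) / 2 ^ k ≤ (j + 1 : ℝ) / 2 ^ k := by gcongr; linarith
    have hcell : Set.Iio ((j + 1 : ℝ) / 2 ^ k) \ Set.Iio ((j : ℝ) / 2 ^ k) = cell k j := by
      ext x; simp [cell]
    have := centeredSum_piece_add_diff (ν := ν) (η := η) (W := W) (n := n) hc
      measurableSet_Iio measurableSet_Iio (Set.Iio_subset_Iio hle) ω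
    rw [hcell] at this
    simp only [hD]
    rw [this, add_sub_cancel_left]
    exact h1 k hk1 hk2 j hj
  have hsum : ∑ i ∈ Finset.range m, ε * s⁻¹ ^ (k₀ + i + 1) ≤ ε / (1 - s⁻¹) := by
    calc _ ≤ ∑ i ∈ Finset.range m, ε * s⁻¹ ^ i := by
          refine Finset.sum_le_sum fun i _ => mul_le_mul_of_nonneg_left ?_ hε
          exact pow_le_pow_of_le_one hsi.le hs1.le (by omega)
      _ = ε * ∑ i ∈ Finset.range m, s⁻¹ ^ i := by rw [Finset.mul_sum]
      _ ≤ ε * (1 - s⁻¹)⁻¹ := by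
          refine mul_le_mul_of_nonneg_left ?_ hε
          rw [← tsum_geometric_of_lt_one hsi.le hs1]
          exact (summable_geometric_of_lt_one hsi.le hs1).sum_le_tsum _ fun i _ => by positivity
      _ = _ := by rw [div_eq_mul_inv]
  set k := k₀ + m with hkm
  set a := ⌊2 ^ k * u⌋₊ with ha
  have hp : (0 : ℝ) < 2 ^ k := by positivity
  have ha1 : (a : ℝ) ≤ 2 ^ k * u := Nat.floor_le (by positivity)
  have ha2 : 2 ^ k * u < a + 1 := Nat.lt_floor_add_one _
  have ha3 : a < 2 ^ k := by
    have : (a : ℝ) < 2 ^ k := lt_of_le_of_lt ha1 (mul_lt_of_lt_one_right (by positivity) hu1)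
    exact_mod_cast this
  have ha4 : (a : ℝ) / 2 ^ k ≤ u := by rw [div_le_iff₀ hp]; linarith
  have hlast : |centeredSum ν η W n (piece c U) ω - D (a / 2 ^ k)| ≤ ε + 2 * E := by
    have hsub : Set.Iio ((a : ℝ) / 2 ^ k) ⊆ U := (Set.Iio_subset_Iio ha4).trans hU1
    have hc2 : U \ Set.Iio ((a : ℝ) / 2 ^ k) ⊆ cell k a := fun x hx => by
      refine ⟨not_lt.1 hx.2, lt_of_le_of_lt (hU2 hx.1) ?_⟩
      rw [lt_div_iff₀ hp]; linarith
    simp only [hD]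
    rw [centeredSum_piece_add_diff hc measurableSet_Iio hU hsub, add_sub_cancel_left]
    refine (abs_centeredSum_piece_le (J := cell k a) hc measurableSet_Ico hc2 ω).trans ?_
    linarith [h2 a ha3, h3 a]
  have := abs_sub_le (centeredSum ν η W n (piece c U) ω) (D (a / 2 ^ k))
    (D (⌊2 ^ k₀ * u⌋₊ / 2 ^ k₀))
  linarith

end

/-! ### Uniform comparison of the perturbed and unperturbed truncated processes. -/

section

variable {Ω : Type*} [mΩ : MeasurableSpace Ω] {P : Measure Ω} [IsProbabilityMeasure P]
  {ν : Measure ℝ} [IsProbabilityMeasure ν] {η : ℕ → Ω → ℝ} {W : ℕ → Ω → ℝ × ℝ}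
  {A : ℕ → MeasurableSpace Ω} {n : ℕ} {κ M C β K c : ℝ}

theorem TameLaw.measure_perturbation_le (T : TameLaw ν κ M C β) (H : AdaptedArray P ν η W A n)
    (hK : ∀ ω, ∑ t ∈ Finset.Icc 1 n, (W t ω).1 ^ 2 ≤ K) {Δ : ℝ} (hΔ : 0 < Δ) (hΔ1 : 2 * Δ ≤ 1)
    (hd : ∀ t ω, |(W t ω).2| ≤ Δ) (hc : 0 ≤ c) {l ε : ℝ} (hl : 0 ≤ l) (hlc : 2 * l * c ≤ 1)
    (u : ℝ) :
    P {ω | ε ≤ |centeredSum ν η W n (piece c (Set.Iio u)) ω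
        - centeredSum ν η (unperturbed W) n (piece c (Set.Iio u)) ω|} ≤
      ENNReal.ofReal (2 * Real.exp (-l * ε + l ^ 2 * (K * (C * (2 * Δ) ^ β)))) := by
  let h : (ℝ × ℝ) × ℝ → ℝ := fun p =>
    piece c (Set.Iio u) p - piece c (Set.Iio u) ((p.1.1, 0), p.2)
  have hpm := measurable_piece c (measurableSet_Iio (a := u))
  have hh : Measurable h := hpm.sub (hpm.comp (by fun_prop))
  have hfac : ∀ p, |h p| = |trunc c (p.1.1 * p.2)| *
      |(Set.Iio u).indicator (1 : ℝ → ℝ) (squash (p.2 / (1 + p.1.2)))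
        - (Set.Iio u).indicator 1 (squash (p.2 / (1 + 0)))| := fun p => by
    simp only [h, piece]
    rw [← mul_sub, abs_mul]
  have hind : ∀ x y : ℝ, |(Set.Iio u).indicator (1 : ℝ → ℝ) x
      - (Set.Iio u).indicator 1 y| ≤ 1 := fun x y => by
    rw [abs_le]
    constructor <;> linarith [indicator_one_nonneg (Set.Iio u) x,
      indicator_one_nonneg (Set.Iio u) y, indicator_one_le_one (Set.Iio u) x,
      indicator_one_le_one (Set.Iio u) y]
  have hsum : ∀ ω, centeredSum ν η W n (piece c (Set.Iio u)) ω
      - centeredSum ν η (MixedEmpirical.unperturbed W) n (piece c (Set.Iio u)) ω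
        = centeredSum ν η W n h ω := fun ω => by
    simp only [centeredSum, ← Finset.sum_sub_distrib]
    refine Finset.sum_congr rfl fun t _ => ?_
    simp only [h, MixedEmpirical.unperturbed]
    rw [integral_sub (integrable_piece hc measurableSet_Iio _)
      (integrable_piece hc measurableSet_Iio _)]
    ring
  simp only [hsum]
  -- The two indicators can differ only if `squash y` lies within `Δ` of `u`; this window is
  -- expressed through the unperturbed error, hence `e = 0`.
  refine T.measure_abs_ge_le H hK hh (fun p => ?_) (u := u - Δ) (w := 2 * Δ) (by linarith) hΔ1
    (I := Set.Icc (u - Δ) (u + Δ)) measurableSet_Icc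
    (Set.Icc_subset_Icc_right (by linarith)) (e := fun _ _ => 0) (by simp) (fun t ω y => ?_)
    hl hlc
  · rw [hfac]
    exact (mul_le_of_le_one_right (abs_nonneg _) (hind _ _)).trans (abs_trunc_le hc _)
  · rw [hfac]
    refine mul_le_mul (abs_trunc_le_abs _ _) ?_ (abs_nonneg _) (abs_nonneg _)
    have hnear := abs_le.1 ((abs_squash_div_sub_le ((hd t ω).trans (by linarith)) y).trans (hd t ω))
    simp only [add_zero, div_one]
    by_cases hy : squash y ∈ Set.Icc (u - Δ) (u + Δ)
    · rw [Set.indicator_of_mem hy]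
      exact hind _ _
    · rw [Set.indicator_of_notMem hy]
      have : squash (y / (1 + (W t ω).2)) ∈ Set.Iio u ↔ squash y ∈ Set.Iio u := by
        rw [Set.mem_Icc, not_and_or, not_le, not_le] at hy
        simp only [Set.mem_Iio]
        constructor <;> intro hx <;> rcases hy with hy | hy <;> linarith
      rw [Set.indicator_apply, Set.indicator_apply]
      simp [this]

/-- The uniform comparison of the perturbed and the unperturbed truncated processes. -/
theorem TameLaw.measure_exists_perturbation_le (T : TameLaw ν κ M C β)
    (H : AdaptedArray P ν η W A n)
    (hK : ∀ ω, ∑ t ∈ Finset.Icc 1 n, (W t ω).1 ^ 2 ≤ K) (hK0 : 0 ≤ K) {Δ : ℝ} (hΔ : 0 < Δ)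
    (hΔ1 : 2 * Δ ≤ 1) (hd : ∀ t ω, |(W t ω).2| ≤ Δ) (hc : 0 ≤ c) {l ε s τ : ℝ} (hl : 0 ≤ l)
    (hlc : 2 * l * c ≤ 1) (hε : 0 < ε) (hτ : 0 < τ) (hs : 1 < s) (hsβ : s ^ 4 ≤ 2 ^ β)
    {k₀ k₁ : ℕ} (hk : k₀ ≤ k₁) (hkc : 2 * s ^ (2 * k₁) * c ≤ 1) :
    P {ω | ∃ u, 0 ≤ u ∧ u < 1 ∧ ε + 2 * (ε / (1 - s⁻¹) + ε
          + 2 * (n * τ + K / τ * (C * ((2 : ℝ) ^ k₁)⁻¹ ^ β))) ≤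
        |centeredSum ν η W n (piece c (Set.Iio u)) ω
          - centeredSum ν η (unperturbed W) n (piece c (Set.Iic u)) ω|} ≤
      4 * ∑' i, chainTerm K C ε s (i + k₀) +
        2 ^ k₀ * ENNReal.ofReal (2 * Real.exp (-l * ε + l ^ 2 * (K * (C * (2 * Δ) ^ β)))) := by
  have hK' : ∀ ω, ∑ t ∈ Finset.Icc 1 n, (MixedEmpirical.unperturbed W t ω).1 ^ 2 ≤ K := hK
  have hd1 : ∀ t ω, |(W t ω).2| ≤ 1 / 2 := fun t ω => (hd t ω).trans (by linarith)
  have hd2 : ∀ t ω, |(MixedEmpirical.unperturbed W t ω).2| ≤ 1 / 2 := fun t ω => by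
    simp [MixedEmpirical.unperturbed]
  have hm1 : ∀ I, MeasurableSet I → Measurable (piece c I) := fun I => measurable_piece c
  have hm2 : ∀ I, MeasurableSet I → Measurable fun p => |piece c I p| :=
    fun I hI => (measurable_piece c hI).abs
  -- There are four exceptional families: the perturbed and unperturbed arrays, each with `piece`
  -- for the chain and `|piece|` for the finest level.
  let bad (V : ℕ → Ω → ℝ × ℝ) (h : Set ℝ → (ℝ × ℝ) × ℝ → ℝ) : Set Ω :=
    {ω | ∃ k, k₀ ≤ k ∧ k ≤ k₁ ∧
      ∃ j < 2 ^ k, ε * s⁻¹ ^ k ≤ |centeredSum ν η V n (h (cell k j)) ω|}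
  have b1 : P (bad W (piece c)) ≤ _ :=
    T.measure_exists_level_le H hK hK0 hd1 hm1 (fun _ _ => le_rfl) hc hs.le hsβ hkc
  have b2 : P (bad W fun I p => |piece c I p|) ≤ _ :=
    T.measure_exists_level_le H hK hK0 hd1 hm2 (fun _ _ => by rw [abs_abs]) hc hs.le hsβ hkc
  have b3 : P (bad (MixedEmpirical.unperturbed W) (piece c)) ≤ _ :=
    T.measure_exists_level_le H.unperturbed hK' hK0 hd2 hm1 (fun _ _ => le_rfl) hc hs.le hsβ hkc
  have b4 : P (bad (MixedEmpirical.unperturbed W) fun I p => |piece c I p|) ≤ _ :=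
    T.measure_exists_level_le H.unperturbed hK' hK0 hd2 hm2 (fun _ _ => by rw [abs_abs])
      hc hs.le hsβ hkc
  let coarse : Set Ω := ⋃ i ∈ Finset.range (2 ^ k₀),
    {ω | ε ≤ |centeredSum ν η W n (piece c (Set.Iio ((i : ℝ) / 2 ^ k₀))) ω
      - centeredSum ν η (MixedEmpirical.unperturbed W) n
        (piece c (Set.Iio ((i : ℝ) / 2 ^ k₀))) ω|}
  have b5 : P coarse ≤ 2 ^ k₀ *
      ENNReal.ofReal (2 * Real.exp (-l * ε + l ^ 2 * (K * (C * (2 * Δ) ^ β)))) := by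
    refine (measure_biUnion_finset_le _ _).trans ((Finset.sum_le_sum fun i _ =>
      T.measure_perturbation_le H hK hΔ hΔ1 hd hc hl hlc _).trans_eq ?_)
    simp
  have hgood : ∀ (V : ℕ → Ω → ℝ × ℝ), (∀ ω, ∑ t ∈ Finset.Icc 1 n, (V t ω).1 ^ 2 ≤ K) →
      (∀ t ω, |(V t ω).2| ≤ 1 / 2) → ∀ ω, ω ∉ bad V (piece c) →
      ω ∉ bad V (fun I p => |piece c I p|) → ∀ u, 0 ≤ u → u < 1 → ∀ U : Set ℝ, MeasurableSet U →
      Set.Iio u ⊆ U → U ⊆ Set.Iic u → |centeredSum ν η V n (piece c U) ω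
        - centeredSum ν η V n (piece c (Set.Iio (⌊2 ^ k₀ * u⌋₊ / 2 ^ k₀))) ω| ≤
        ε / (1 - s⁻¹) + ε + 2 * (n * τ + K / τ * (C * ((2 : ℝ) ^ k₁)⁻¹ ^ β)) := by
    intro V hV1 hV2 ω hω1 hω2 u hu0 hu1 U hU hU1 hU2
    refine abs_centeredSum_sub_floor_le hc hs hε.le hk (fun k h1 h2 j hj => ?_) (fun j hj => ?_)
      (fun j => T.sum_integral_abs_piece_cell_le hV1 hV2 hτ k₁ j ω) hu0 hu1 hU hU1 hU2
    · by_contra hcon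
      exact hω1 ⟨k, h1, h2, j, hj, (not_le.1 hcon).le⟩
    · by_contra hcon
      refine hω2 ⟨k₁, hk, le_rfl, j, hj, le_trans ?_ (not_le.1 hcon).le⟩
      exact mul_le_of_le_one_right hε.le
        (pow_le_one₀ (by positivity) (inv_le_one_of_one_le₀ hs.le))
  have hsub : {ω | ∃ u, 0 ≤ u ∧ u < 1 ∧ ε + 2 * (ε / (1 - s⁻¹) + ε
          + 2 * (n * τ + K / τ * (C * ((2 : ℝ) ^ k₁)⁻¹ ^ β))) ≤
        |centeredSum ν η W n (piece c (Set.Iio u)) ω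
          - centeredSum ν η (MixedEmpirical.unperturbed W) n (piece c (Set.Iic u)) ω|} ⊆
      (((bad W (piece c) ∪ bad W fun I p => |piece c I p|) ∪
        bad (MixedEmpirical.unperturbed W) (piece c)) ∪
          bad (MixedEmpirical.unperturbed W) fun I p => |piece c I p|) ∪ coarse := by
    rintro ω ⟨u, hu0, hu1, hω⟩
    by_contra hcon
    simp only [Set.mem_union, not_or] at hcon
    obtain ⟨⟨⟨⟨h1, h2⟩, h3⟩, h4⟩, h5⟩ := hcon
    have g1 := hgood W hK hd1 ω h1 h2 u hu0 hu1 (Set.Iio u) measurableSet_Iio le_rfl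
      Set.Iio_subset_Iic_self
    have g2 := hgood _ hK' hd2 ω h3 h4 u hu0 hu1 (Set.Iic u) measurableSet_Iic
      Set.Iio_subset_Iic_self le_rfl
    have hfl : ⌊2 ^ k₀ * u⌋₊ ∈ Finset.range (2 ^ k₀) := by
      rw [Finset.mem_range, Nat.floor_lt (by positivity)]
      push_cast
      exact mul_lt_of_lt_one_right (by positivity) hu1
    have g3 : |centeredSum ν η W n (piece c (Set.Iio (⌊2 ^ k₀ * u⌋₊ / 2 ^ k₀))) ω
        - centeredSum ν η (MixedEmpirical.unperturbed W) n
          (piece c (Set.Iio (⌊2 ^ k₀ * u⌋₊ / 2 ^ k₀))) ω| < ε := by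
      by_contra hcon
      exact h5 (Set.mem_biUnion hfl (not_lt.1 hcon))
    rw [abs_le] at g1 g2
    rw [abs_lt] at g3
    have : |centeredSum ν η W n (piece c (Set.Iio u)) ω
        - centeredSum ν η (MixedEmpirical.unperturbed W) n (piece c (Set.Iic u)) ω| <
        ε + 2 * (ε / (1 - s⁻¹) + ε
          + 2 * (n * τ + K / τ * (C * ((2 : ℝ) ^ k₁)⁻¹ ^ β))) := by
      rw [abs_lt]
      constructor <;> linarith [g1.1, g1.2, g2.1, g2.2, g3.1, g3.2]
    exact absurd hω (not_le.2 this)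
  refine (measure_mono hsub).trans ?_
  refine (measure_union_le _ _).trans (add_le_add ?_ b5)
  refine (measure_union_le _ _).trans ((add_le_add ((measure_union_le _ _).trans
    (add_le_add ((measure_union_le _ _).trans (add_le_add b1 b2)) b3)) b4).trans_eq ?_)
  ring

end

/-! ### Stochastic orders and the expansion of `Jtilde`. -/

theorem isLittleOPOne_of_eventually_le {Ω : Type*} [MeasurableSpace Ω] {P : Measure Ω}
    {Y : ℕ → Ω → ℝ≥0∞} (h : ∀ ε : ℝ, 0 < ε → ∀ θ : ℝ≥0∞, 0 < θ →
      ∀ᶠ n in atTop, P {ω | ENNReal.ofReal ε ≤ Y n ω} ≤ θ) : IsLittleOPOne P Y := by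
  intro ε hε
  rw [ENNReal.tendsto_nhds_zero]
  intro θ hθ
  obtain ⟨r, hr0, hr⟩ := ENNReal.lt_iff_exists_real_btwn.1 hε
  have hr1 : 0 < r := ENNReal.ofReal_pos.1 hr.1
  filter_upwards [h r hr1 θ hθ] with n hn
  exact (measure_mono fun ω hω => hr.2.le.trans hω).trans hn

theorem IsLittleOPOne.add {Ω : Type*} [MeasurableSpace Ω] {P : Measure Ω}
    {X Y Z : ℕ → Ω → ℝ≥0∞} (hX : IsLittleOPOne P X) (hY : IsLittleOPOne P Y)
    (h : ∀ n ω, Z n ω ≤ X n ω + Y n ω) : IsLittleOPOne P Z := by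
  intro ε hε
  have h2 : 0 < ε / 2 := ENNReal.half_pos hε.ne'
  have := (hX _ h2).add (hY _ h2)
  rw [add_zero] at this
  refine tendsto_of_tendsto_of_tendsto_of_le_of_le tendsto_const_nhds this (fun _ => zero_le)
    fun n => (measure_mono fun ω hω => ?_).trans (measure_union_le _ _)
  by_contra hcon
  simp only [Set.mem_union, not_or] at hcon
  have h3 : X n ω < ε / 2 := not_le.1 hcon.1
  have h4 : Y n ω < ε / 2 := not_le.1 hcon.2
  have h5 := (hω.trans (h n ω)).trans_lt (ENNReal.add_lt_add h3 h4)
  rw [ENNReal.add_halves] at h5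
  exact lt_irrefl _ h5

/-- The modulus of scale smoothness. -/
noncomputable def scaleModulus (g : ℝ → ℝ) (d : ℝ) : ℝ≥0∞ :=
  ⨆ x : ℝ, ENNReal.ofReal |x| * ∫⁻ h in Set.Icc (0 : ℝ) 1,
    ENNReal.ofReal |x * g x - (x + h * x * d) * g (x + h * x * d)|

theorem mu_sub_mu {g : ℝ → ℝ} (hi : Integrable fun s => s * g s) (x y : ℝ) :
    mu g y - mu g x = ∫ s in x..y, s * g s :=
  intervalIntegral.integral_Iic_sub_Iic hi.integrableOn hi.integrableOn

theorem abs_mu_sub_linear_le {g : ℝ → ℝ} (hi : Integrable fun s => s * g s) (x d : ℝ) :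
    ENNReal.ofReal |mu g (x + x * d) - mu g x - x ^ 2 * g x * d| ≤
      ENNReal.ofReal |d| * scaleModulus g d := by
  -- The substitution `h ↦ x + x d h` preserves integrability only when `x d ≠ 0`.
  by_cases hxd : x * d = 0
  · have : x ^ 2 * g x * d = x * d * (x * g x) := by ring
    rw [this, hxd]
    simp
  set f : ℝ → ℝ := fun s => s * g s with hf
  have h1 : mu g (x + x * d) - mu g x = x * d * ∫ h in (0 : ℝ)..1, f (x + x * d * h) := by
    rw [mu_sub_mu hi]
    have := intervalIntegral.smul_integral_comp_add_mul (a := 0) (b := 1) f (x * d) x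
    rw [mul_zero, add_zero, mul_one] at this
    exact this.symm
  have hi1 : IntervalIntegrable (fun h => f (x + x * d * h)) volume 0 1 :=
    ((hi.comp_add_left x).comp_mul_left' hxd).intervalIntegrable
  have h2 : mu g (x + x * d) - mu g x - x ^ 2 * g x * d
      = x * d * ∫ h in (0 : ℝ)..1, (f (x + x * d * h) - f x) := by
    rw [intervalIntegral.integral_sub hi1 (by simp), h1]
    simp [hf]
    ring
  have h3 : ENNReal.ofReal |∫ h in (0 : ℝ)..1, (f (x + x * d * h) - f x)| ≤
      ∫⁻ h in Set.Icc (0 : ℝ) 1, ENNReal.ofReal |x * g x - (x + h * x * d) * g (x + h * x * d)| := by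
    rw [intervalIntegral.integral_of_le zero_le_one, ← Real.enorm_eq_ofReal_abs]
    refine (enorm_integral_le_lintegral_enorm _).trans ?_
    refine (lintegral_mono_set Set.Ioc_subset_Icc_self).trans_eq ?_
    refine lintegral_congr fun h => ?_
    rw [Real.enorm_eq_ofReal_abs, abs_sub_comm]
    simp only [hf, show x * d * h = h * x * d by ring]
  rw [h2, abs_mul, abs_mul, ENNReal.ofReal_mul (by positivity), ENNReal.ofReal_mul (abs_nonneg _),
    mul_comm (ENNReal.ofReal |x|), mul_assoc]
  gcongr
  refine le_trans (mul_le_mul_right h3 _) ?_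
  exact le_iSup (fun x : ℝ => ENNReal.ofReal |x| * ∫⁻ h in Set.Icc (0 : ℝ) 1,
    ENNReal.ofReal |x * g x - (x + h * x * d) * g (x + h * x * d)|) x

theorem abs_Jtilde_sub_le {Ω : Type*} {g : ℝ → ℝ} (hi : Integrable fun s => s * g s)
    {γ δ : ℕ → ℕ → Ω → ℝ} {n : ℕ} {ω : Ω} {ρ : ℝ} (hρ : 0 ≤ ρ)
    (h : ∀ t ∈ Finset.Icc 1 n, δ n t ω ≠ 0 → scaleModulus g (δ n t ω) ≤ ENNReal.ofReal ρ) (x : ℝ) :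
    ENNReal.ofReal |Jtilde g γ δ n x ω - Jstar g γ n x ω - linTerm g γ δ n x ω| ≤
      ENNReal.ofReal (ρ * ((√(n : ℝ))⁻¹ * ∑ t ∈ Finset.Icc 1 n, |γ n t ω * δ n t ω|)) := by
  have hterm : ∀ t ∈ Finset.Icc 1 n,
      |mu g (x + x * δ n t ω) - mu g x - x ^ 2 * g x * δ n t ω| ≤ |δ n t ω| * ρ := by
    intro t ht
    have h1 := abs_mu_sub_linear_le hi x (δ n t ω)
    -- The limit in scale smoothness is over a punctured neighbourhood, so a vanishing perturbation
    -- is treated apart; its term is zero.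
    by_cases h0 : δ n t ω = 0
    · simp [h0]
    · have := h1.trans (mul_le_mul_right (h t ht h0) _)
      rw [← ENNReal.ofReal_mul (abs_nonneg _)] at this
      exact (ENNReal.ofReal_le_ofReal_iff (by positivity)).1 this
  have heq : Jtilde g γ δ n x ω - Jstar g γ n x ω - linTerm g γ δ n x ω =
      (√(n : ℝ))⁻¹ * ∑ t ∈ Finset.Icc 1 n,
        γ n t ω * (mu g (x + x * δ n t ω) - mu g x - x ^ 2 * g x * δ n t ω) := by
    unfold Jtilde Jstar linTerm
    simp only [mul_sub, Finset.sum_sub_distrib]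
    rw [mul_left_comm, Finset.mul_sum _ _ (x ^ 2 * g x)]
    congr 3
    ext t
    ring
  refine ENNReal.ofReal_le_ofReal ?_
  rw [heq, abs_mul, abs_of_nonneg (by positivity : 0 ≤ (√(n : ℝ))⁻¹), mul_left_comm]
  refine mul_le_mul_of_nonneg_left ?_ (by positivity)
  rw [Finset.mul_sum]
  refine (Finset.abs_sum_le_sum_abs _ _).trans (Finset.sum_le_sum fun t ht => ?_)
  rw [abs_mul, abs_mul]
  have := mul_le_mul_of_nonneg_left (hterm t ht) (abs_nonneg (γ n t ω))
  linarith

theorem integrable_id_mul_of_setup {Ω : Type*} [MeasurableSpace Ω] {P : Measure Ω}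
    [IsProbabilityMeasure P] {g : ℝ → ℝ} {η : ℕ → Ω → ℝ} {γ δ : ℕ → ℕ → Ω → ℝ}
    {A : ℕ → ℕ → MeasurableSpace Ω} (hg : IsCenteredPosDensity g) (hA1 : AssumptionA1 g)
    (hsetup : Setup P g η γ δ A) : Integrable fun s => s * g s := by
  obtain ⟨κ, M, C, β, T⟩ := exists_tameLaw hg hA1
  have : IsProbabilityMeasure (volume.withDensity fun x => ENNReal.ofReal (g x)) := by
    rw [← hsetup.law_eta 1 le_rfl]
    exact Measure.isProbabilityMeasure_map (hsetup.measurable_eta 1 le_rfl).aemeasurable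
  exact (integrable_withDensity_ofReal hg.measurable fun x => (hg.pos x).le).1 T.integrable_id

theorem isLittleOPOne_Jtilde {Ω : Type*} [MeasurableSpace Ω] {P : Measure Ω}
    {g : ℝ → ℝ} {γ δ : ℕ → ℕ → Ω → ℝ} {q a : ℝ} (hi : Integrable fun s => s * g s)
    (hA1 : AssumptionA1 g) (hw : WeightConditions P γ δ q a) :
    IsLittleOPOne P (fun n ω => ⨆ x : ℝ, ENNReal.ofReal
      |Jtilde g γ δ n x ω - Jstar g γ n x ω - linTerm g γ δ n x ω|) := by
  refine isLittleOPOne_of_eventually_le fun ε hε θ hθ => ?_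
  have hθ2 : 0 < θ / 2 := ENNReal.half_pos hθ.ne'
  obtain ⟨M, hM⟩ := hw.gamma_delta _ hθ2
  -- The bound `M` from `O_P(1)` may be nonpositive; `M'` is a positive bound, so that `ρ` is
  -- defined and positive.
  set M' := max M 0 + 1 with hM'
  have hM0 : 0 < M' := by positivity
  set ρ := ε / (2 * M') with hρ
  have hρ0 : 0 < ρ := by positivity
  have hsm : Tendsto (scaleModulus g) (𝓝[≠] 0) (𝓝 0) := hA1.scale_smooth
  have hev := hsm.eventually_le_const (ENNReal.ofReal_pos.2 hρ0)
  rw [eventually_nhdsWithin_iff, Metric.eventually_nhds_iff] at hev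
  obtain ⟨Δ, hΔ, hev⟩ := hev
  have hδ := hw.max_delta (ENNReal.ofReal Δ) (ENNReal.ofReal_pos.2 hΔ)
  filter_upwards [hM, (ENNReal.tendsto_nhds_zero.1 hδ) _ hθ2] with n h1 h2
  rw [← ENNReal.add_halves θ]
  refine (measure_mono fun ω hω => ?_).trans ((measure_union_le _ _).trans (add_le_add h1 h2))
  by_contra hcon
  simp only [Set.mem_union, not_or] at hcon
  have h3 : |(√(n : ℝ))⁻¹ * (∑ t ∈ Finset.Icc 1 n, |γ n t ω * δ n t ω|)| ≤ M := not_lt.1 hcon.1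
  have h4 : (⨆ t ∈ Finset.Icc 1 n, ENNReal.ofReal |δ n t ω|) < ENNReal.ofReal Δ :=
    not_le.1 hcon.2
  have h5 : ∀ t ∈ Finset.Icc 1 n, δ n t ω ≠ 0 →
      scaleModulus g (δ n t ω) ≤ ENNReal.ofReal ρ := fun t ht h0 => by
    refine hev ?_ h0
    rw [Real.dist_eq, sub_zero]
    have := (le_iSup₂ (f := fun t (_ : t ∈ Finset.Icc 1 n) => ENNReal.ofReal |δ n t ω|) t ht).trans_lt
      h4
    exact (ENNReal.ofReal_lt_ofReal_iff hΔ).1 this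
  have h6 : ENNReal.ofReal ε ≤ ENNReal.ofReal (ε / 2) := by
    refine hω.trans (iSup_le fun x => (abs_Jtilde_sub_le hi hρ0.le h5 x).trans
      (ENNReal.ofReal_le_ofReal ?_))
    have h7 : (√(n : ℝ))⁻¹ * ∑ t ∈ Finset.Icc 1 n, |γ n t ω * δ n t ω| ≤ M' :=
      (le_abs_self _).trans (h3.trans (by rw [hM']; linarith [le_max_left M 0]))
    calc _ ≤ ρ * M' := mul_le_mul_of_nonneg_left h7 hρ0.le
      _ = ε / 2 := by rw [hρ]; field_simp
  rw [ENNReal.ofReal_le_ofReal_iff (by positivity)] at h6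
  linarith

/-! ### Truncated weights, large jumps and the error from truncating summands. -/

/-- The weight `γ_t`, set to zero when it exceeds `L` or the sum of squares up to `t` exceeds
`B`. -/
noncomputable def truncWeight {Ω : Type*} (L B : ℝ) (γ : ℕ → Ω → ℝ) (t : ℕ) (ω : Ω) : ℝ :=
  if |γ t ω| ≤ L ∧ ∑ s ∈ Finset.Icc 1 t, γ s ω ^ 2 ≤ B then γ t ω else 0

theorem sum_truncWeight_sq_le {Ω : Type*} {L B : ℝ} (hB : 0 ≤ B) (γ : ℕ → Ω → ℝ) (m : ℕ) (ω : Ω) :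
    ∑ t ∈ Finset.Icc 1 m, truncWeight L B γ t ω ^ 2 ≤ B := by
  -- The second bound carries the induction: if the weight at `m + 1` is kept, the original sum of
  -- squares up to `m + 1` is at most `B` and dominates the truncated one.
  suffices h : ∑ t ∈ Finset.Icc 1 m, truncWeight L B γ t ω ^ 2 ≤ B ∧
      ∑ t ∈ Finset.Icc 1 m, truncWeight L B γ t ω ^ 2 ≤ ∑ t ∈ Finset.Icc 1 m, γ t ω ^ 2 from h.1
  induction m with
  | zero => simpa using hB
  | succ m ih =>
    rw [Finset.sum_Icc_succ_top (by omega), Finset.sum_Icc_succ_top (by omega)]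
    by_cases h : |γ (m + 1) ω| ≤ L ∧ ∑ s ∈ Finset.Icc 1 (m + 1), γ s ω ^ 2 ≤ B
    · have h2 := h.2
      rw [Finset.sum_Icc_succ_top (by omega)] at h2
      have : truncWeight L B γ (m + 1) ω = γ (m + 1) ω := if_pos h
      rw [this]
      constructor <;> linarith [ih.2]
    · have : truncWeight L B γ (m + 1) ω = 0 := if_neg h
      rw [this]
      constructor <;> nlinarith [ih.1, ih.2, sq_nonneg (γ (m + 1) ω)]

theorem abs_truncWeight_le {Ω : Type*} {L B : ℝ} (hL : 0 ≤ L) (γ : ℕ → Ω → ℝ) (t : ℕ) (ω : Ω) :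
    |truncWeight L B γ t ω| ≤ L := by
  unfold truncWeight
  split_ifs with h
  · exact h.1
  · simpa using hL

theorem measurable_truncWeight {Ω : Type*} [MeasurableSpace Ω] {L B : ℝ} {γ : ℕ → Ω → ℝ} {t : ℕ}
    (ht : 1 ≤ t) (h : ∀ s, 1 ≤ s → s ≤ t → Measurable (γ s)) :
    Measurable (truncWeight L B γ t) := by
  have hS : Measurable fun ω => ∑ s ∈ Finset.Icc 1 t, γ s ω ^ 2 :=
    Finset.measurable_fun_sum _ fun s hs =>
      (h s (Finset.mem_Icc.1 hs).1 (Finset.mem_Icc.1 hs).2).pow_const 2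
  have hγ := h t ht le_rfl
  exact Measurable.ite ((measurableSet_le (measurable_abs.comp hγ) measurable_const).inter
    (measurableSet_le hS measurable_const)) hγ measurable_const

/-- The truncated and normalized weights, paired with the truncated perturbations. -/
noncomputable def truncArray {Ω : Type*} (n : ℕ) (L B Δ : ℝ) (γ δ : ℕ → Ω → ℝ) (t : ℕ) (ω : Ω) :
    ℝ × ℝ :=
  ((√(n : ℝ))⁻¹ * truncWeight L B γ t ω, trunc Δ (δ t ω))

theorem sum_truncArray_sq_le {Ω : Type*} {n : ℕ} {L K Δ : ℝ} (hK : 0 ≤ K) (γ δ : ℕ → Ω → ℝ)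
    (ω : Ω) : ∑ t ∈ Finset.Icc 1 n, (truncArray n L (n * K) Δ γ δ t ω).1 ^ 2 ≤ K := by
  simp only [truncArray, mul_pow, ← Finset.mul_sum, inv_pow, Real.sq_sqrt (Nat.cast_nonneg n)]
  rcases Nat.eq_zero_or_pos n with rfl | hn
  · simpa using hK
  · have : (0 : ℝ) < n := by exact_mod_cast hn
    rw [inv_mul_le_iff₀ this]
    exact sum_truncWeight_sq_le (by positivity) γ n ω

/-- Cutting the weight at `t` by the sum of squares up to `t`, not up to `n`, keeps it measurable
for `A n t`. -/
theorem Setup.adaptedArray {Ω : Type*} [mΩ : MeasurableSpace Ω] {P : Measure Ω} {g : ℝ → ℝ}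
    {η : ℕ → Ω → ℝ} {γ δ : ℕ → ℕ → Ω → ℝ} {A : ℕ → ℕ → MeasurableSpace Ω}
    (H : Setup P g η γ δ A)
    (hind : ∀ n t, 1 ≤ t → t ≤ n → Indep (MeasurableSpace.comap (η t) inferInstance) (A n t) P)
    (n : ℕ) (L B Δ : ℝ) :
    AdaptedArray P (volume.withDensity fun x => ENNReal.ofReal (g x)) η
      (truncArray n L B Δ (γ n) (δ n)) (A n) n where
  sub := H.sub n
  meas t h1 _ := H.measurable_eta t h1
  law t h1 _ := H.law_eta t h1
  indep := hind n
  weights t j h1 h2 h3 := by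
    have hδ := H.adapted_delta n t j h1 h2 h3
    have hW : Measurable[A n j] (truncWeight L B (γ n) t) :=
      @measurable_truncWeight Ω (A n j) L B (γ n) t h1 fun s hs1 hs2 =>
        H.adapted_gamma n s j hs1 (hs2.trans h2) h3
    exact (hW.const_mul _).prodMk ((measurable_trunc Δ).comp hδ)
  past := H.adapted_eta n

section

variable {Ω : Type*} [mΩ : MeasurableSpace Ω] {P : Measure Ω} [IsProbabilityMeasure P]
  {ν : Measure ℝ} {η : ℕ → Ω → ℝ} {W : ℕ → Ω → ℝ × ℝ}
  {A : ℕ → MeasurableSpace Ω} {n : ℕ} {κ M C β K c r : ℝ}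

theorem TameLaw.moment_nonneg {ν : Measure ℝ} {κ M C β : ℝ} (T : TameLaw ν κ M C β) : 0 ≤ M :=
  (integral_nonneg fun _ => by positivity).trans T.moment_le

theorem abs_rpow_two_add_le {κ r z : ℝ} (hκ : 0 < κ) (hz : |z| ≤ r) :
    |z| ^ (2 + κ) ≤ z ^ 2 * r ^ κ := by
  rw [Real.rpow_add_of_nonneg (abs_nonneg z) (by norm_num) hκ.le, Real.rpow_two, sq_abs]
  gcongr

/-- Markov's inequality with exponent `2 + κ`, conditionally on the weights. Small weights give
`|w|^{2+κ} ≤ w² r^κ`, and the squares sum to at most `K`. -/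
theorem TameLaw.measure_exists_jump_le (T : TameLaw ν κ M C β) (H : AdaptedArray P ν η W A n)
    (hK : ∀ ω, ∑ t ∈ Finset.Icc 1 n, (W t ω).1 ^ 2 ≤ K)
    (hr : ∀ t ω, |(W t ω).1| ≤ r) (hr0 : 0 ≤ r) (hc : 0 < c) :
    P {ω | ∃ t ∈ Finset.Icc 1 n, c < |(W t ω).1 * η t ω|} ≤
      ENNReal.ofReal (K * (r ^ κ * M / c ^ (2 + κ))) := by
  have hκ := T.kappa_pos
  have hM := T.moment_nonneg
  have hcp : 0 < c ^ (2 + κ) := Real.rpow_pos_of_pos hc _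
  have hterm : ∀ t ∈ Finset.Icc 1 n, P {ω | c < |(W t ω).1 * η t ω|} ≤
      ∫⁻ ω, ENNReal.ofReal ((W t ω).1 ^ 2 * (r ^ κ * M / c ^ (2 + κ))) ∂P := by
    intro t ht
    rw [Finset.mem_Icc] at ht
    have hw := H.weights t t ht.1 le_rfl ht.2
    have hsub := H.sub t ht.1 ht.2
    have hwm : Measurable (W t) := hw.mono hsub le_rfl
    have hη := H.meas t ht.1 ht.2
    let F : Ω × ℝ → ℝ≥0∞ := fun p => ENNReal.ofReal (|(W t p.1).1 * p.2| ^ (2 + κ) / c ^ (2 + κ))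
    have hF : @Measurable _ _ (@Prod.instMeasurableSpace _ _ (A t) _) _ F := by
      let _ : MeasurableSpace Ω := A t
      have hW1 : Measurable fun p : Ω × ℝ => (W t p.1).1 :=
        measurable_fst.comp (hw.comp measurable_fst)
      have : Measurable fun p : Ω × ℝ => |(W t p.1).1 * p.2| ^ (2 + κ) / c ^ (2 + κ) :=
        ((measurable_abs.comp (hW1.mul measurable_snd)).pow_const _).div_const _
      exact ENNReal.measurable_ofReal.comp this
    have hset : MeasurableSet {ω | c < |(W t ω).1 * η t ω|} :=
      measurableSet_lt measurable_const
        (measurable_abs.comp ((measurable_fst.comp hwm).mul hη))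
    calc P {ω | c < |(W t ω).1 * η t ω|}
        = ∫⁻ ω, {ω | c < |(W t ω).1 * η t ω|}.indicator 1 ω ∂P := (lintegral_indicator_one hset).symm
      _ ≤ ∫⁻ ω, F (ω, η t ω) ∂P := by
          refine lintegral_mono fun ω => Set.indicator_apply_le' (fun hω => ?_) fun _ => zero_le
          have hω : c < |(W t ω).1 * η t ω| := hω
          simp only [F, Pi.one_apply]
          rw [ENNReal.one_le_ofReal, one_le_div hcp]
          exact Real.rpow_le_rpow hc.le hω.le (by linarith)
      _ = ∫⁻ ω, ∫⁻ y, F (ω, y) ∂ν ∂P := by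
          rw [lintegral_freeze hsub hη (H.indep t ht.1 ht.2) hF, H.law t ht.1 ht.2]
      _ ≤ _ := by
          refine lintegral_mono fun ω => ?_
          have h1 : ∀ y, F (ω, y) = ENNReal.ofReal
              (|(W t ω).1| ^ (2 + κ) / c ^ (2 + κ) * |y| ^ (2 + κ)) := fun y => by
            simp only [F]
            rw [abs_mul, Real.mul_rpow (abs_nonneg _) (abs_nonneg _)]
            ring_nf
          simp only [h1]
          rw [← ofReal_integral_eq_lintegral_ofReal (T.integrable.const_mul _)
            (ae_of_all _ fun y => by positivity), integral_const_mul]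
          refine ENNReal.ofReal_le_ofReal ?_
          calc _ ≤ (W t ω).1 ^ 2 * r ^ κ / c ^ (2 + κ) * M := by
                gcongr
                · exact abs_rpow_two_add_le hκ (hr t ω)
                · exact T.moment_le
            _ = _ := by ring
  have hU : {ω | ∃ t ∈ Finset.Icc 1 n, c < |(W t ω).1 * η t ω|} ⊆
      ⋃ t ∈ Finset.Icc 1 n, {ω | c < |(W t ω).1 * η t ω|} := by
    rintro ω ⟨t, ht, hω⟩
    exact Set.mem_biUnion ht hω
  refine (measure_mono hU).trans ((measure_biUnion_finset_le _ _).trans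
    ((Finset.sum_le_sum hterm).trans ?_))
  rw [← lintegral_finsetSum']
  · calc _ ≤ ∫⁻ _ : Ω, ENNReal.ofReal (K * (r ^ κ * M / c ^ (2 + κ))) ∂P := by
          refine lintegral_mono fun ω => ?_
          rw [← ENNReal.ofReal_sum_of_nonneg fun t _ => by positivity, ← Finset.sum_mul]
          have := hK ω
          gcongr
      _ = _ := by simp
  · intro t ht
    rw [Finset.mem_Icc] at ht
    have hwm : Measurable (W t) :=
      (H.weights t t ht.1 le_rfl ht.2).mono (H.sub t ht.1 ht.2) le_rfl
    exact (((measurable_fst.comp hwm).pow_const 2).mul_const _).ennreal_ofReal.aemeasurable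

/-- Truncation removes only values above `c`, and there `|v| ≤ |v|^{2+κ} / c^{1+κ}`. -/
theorem TameLaw.sum_abs_integral_sub_piece_le [IsProbabilityMeasure ν] {Ω : Type*} {W : ℕ → Ω → ℝ × ℝ}
    (T : TameLaw ν κ M C β)
    (hK : ∀ ω, ∑ t ∈ Finset.Icc 1 n, (W t ω).1 ^ 2 ≤ K)
    (hr : ∀ t ω, |(W t ω).1| ≤ r) (hr0 : 0 ≤ r) (hc : 0 < c) {I : Set ℝ} (hI : MeasurableSet I)
    (ω : Ω) :
    ∑ t ∈ Finset.Icc 1 n, |(W t ω).1 * (∫ y, y * I.indicator 1 (squash (y / (1 + (W t ω).2))) ∂ν)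
        - ∫ y, piece c I (W t ω, y) ∂ν| ≤ K * (r ^ κ * M / c ^ (1 + κ)) := by
  have hκ := T.kappa_pos
  have hM := T.moment_nonneg
  have hcp : 0 < c ^ (1 + κ) := Real.rpow_pos_of_pos hc _
  calc _ ≤ ∑ t ∈ Finset.Icc 1 n, (W t ω).1 ^ 2 * (r ^ κ * M / c ^ (1 + κ)) := by
        refine Finset.sum_le_sum fun t _ => ?_
        have hmI : Measurable fun y : ℝ =>
            I.indicator (1 : ℝ → ℝ) (squash (y / (1 + (W t ω).2))) :=
          (measurable_one.indicator hI).comp (measurable_squash.comp (by fun_prop))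
        have hi1 : Integrable (fun y : ℝ => (W t ω).1 *
            (y * I.indicator 1 (squash (y / (1 + (W t ω).2))))) ν := by
          refine Integrable.const_mul (T.integrable_id.mono
            (measurable_id.mul hmI).aestronglyMeasurable (ae_of_all _ fun y => ?_)) _
          change |y * I.indicator 1 (squash (y / (1 + (W t ω).2)))| ≤ |y|
          rw [abs_mul, abs_of_nonneg (indicator_one_nonneg I _)]
          exact mul_le_of_le_one_right (abs_nonneg y) (indicator_one_le_one _ _)
        rw [← integral_const_mul, ← integral_sub hi1 (integrable_piece hc.le hI _)]
        refine (abs_integral_le_integral_abs).trans ?_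
        have hpt : ∀ y, |(W t ω).1 * (y * I.indicator 1 (squash (y / (1 + (W t ω).2))))
            - piece c I (W t ω, y)| ≤
              (W t ω).1 ^ 2 * (r ^ κ / c ^ (1 + κ)) * |y| ^ (2 + κ) := by
          intro y
          have h0 : 0 ≤ (W t ω).1 ^ 2 * (r ^ κ / c ^ (1 + κ)) * |y| ^ (2 + κ) := by positivity
          rw [piece, ← mul_assoc, ← sub_mul, abs_mul,
            abs_of_nonneg (indicator_one_nonneg I _)]
          refine (mul_le_of_le_one_right (abs_nonneg _) (indicator_one_le_one _ _)).trans ?_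
          unfold trunc
          split_ifs with h
          · simpa using h0
          · rw [sub_zero]
            push Not at h
            simp only at h ⊢
            set v := (W t ω).1 * y with hv
            have h1 : |v| * c ^ (1 + κ) ≤ |v| ^ (2 + κ) := by
              rw [show 2 + κ = 1 + (1 + κ) by ring, Real.rpow_add (hc.trans h), Real.rpow_one]
              gcongr
            have h2 : |v| ^ (2 + κ) ≤ (W t ω).1 ^ 2 * r ^ κ * |y| ^ (2 + κ) := by
              rw [hv, abs_mul, Real.mul_rpow (abs_nonneg _) (abs_nonneg _)]
              gcongr
              exact abs_rpow_two_add_le hκ (hr t ω)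
            calc |v| ≤ (W t ω).1 ^ 2 * r ^ κ * |y| ^ (2 + κ) / c ^ (1 + κ) := by
                  rw [le_div_iff₀ hcp]; exact h1.trans h2
              _ = _ := by ring
        refine (integral_mono_of_nonneg (ae_of_all _ fun y => abs_nonneg _)
          (T.integrable.const_mul _) (ae_of_all _ hpt)).trans ?_
        rw [integral_const_mul]
        calc _ ≤ (W t ω).1 ^ 2 * (r ^ κ / c ^ (1 + κ)) * M := by
              have := T.moment_le
              gcongr
          _ = _ := by ring
    _ ≤ _ := by
        rw [← Finset.sum_mul]
        have := hK ω
        gcongr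

end

/-! ### The original processes as centered sums. -/

theorem mu_eq_integral_Iio {g : ℝ → ℝ} (hg : IsCenteredPosDensity g) {d : ℝ} (hd : |d| ≤ 1 / 2)
    (x : ℝ) : mu g (x + x * d) = ∫ y, y * (Set.Iio (squash x)).indicator 1 (squash (y / (1 + d)))
      ∂(volume.withDensity fun x => ENNReal.ofReal (g x)) := by
  rw [integral_withDensity_ofReal hg.measurable fun x => (hg.pos x).le, mu,
    integral_Iic_eq_integral_Iio, ← integral_indicator measurableSet_Iio]
  congr 1
  ext y
  have := lt_mul_iff_squash_lt hd x y
  by_cases h : y < x + x * d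
  · rw [Set.indicator_of_mem (show y ∈ Set.Iio _ from h),
      Set.indicator_of_mem (show _ ∈ Set.Iio _ from this.1 h)]
    simp
  · rw [Set.indicator_of_notMem (show y ∉ Set.Iio _ from h),
      Set.indicator_of_notMem (show _ ∉ Set.Iio _ from fun h' => h (this.2 h'))]
    simp

theorem mu_eq_integral_Iic {g : ℝ → ℝ} (hg : IsCenteredPosDensity g)
    (x : ℝ) : mu g x = ∫ y, y * (Set.Iic (squash x)).indicator 1 (squash (y / (1 + 0)))
      ∂(volume.withDensity fun x => ENNReal.ofReal (g x)) := by
  rw [integral_withDensity_ofReal hg.measurable fun x => (hg.pos x).le, mu,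
    ← integral_indicator measurableSet_Iic]
  congr 1
  ext y
  simp only [Set.indicator_apply, Set.mem_Iic, add_zero, div_one, squash_strictMono.le_iff_le]
  split_ifs <;> simp

section

variable {Ω : Type*} {g : ℝ → ℝ}
  [IsProbabilityMeasure (volume.withDensity fun x => ENNReal.ofReal (g x))]
  {η : ℕ → Ω → ℝ} {γ δ : ℕ → ℕ → Ω → ℝ} {W : ℕ → Ω → ℝ × ℝ} {n : ℕ} {κ M C β K c r : ℝ} {ω : Ω}

/-- When no truncation is active at `ω`, the random summands agree exactly; only the conditional
means differ, by the part above level `c`. -/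
theorem abs_Vtilde_sub_Jtilde_sub_le (hg : IsCenteredPosDensity g)
    (T : TameLaw (volume.withDensity fun x => ENNReal.ofReal (g x)) κ M C β)
    (hK : ∀ ω, ∑ t ∈ Finset.Icc 1 n, (W t ω).1 ^ 2 ≤ K) (hr : ∀ t ω, |(W t ω).1| ≤ r)
    (hr0 : 0 ≤ r) (hc : 0 < c) (hd : ∀ t ω, |(W t ω).2| ≤ 1 / 2)
    (hW1 : ∀ t ∈ Finset.Icc 1 n, (W t ω).1 = (√(n : ℝ))⁻¹ * γ n t ω)
    (hW2 : ∀ t ∈ Finset.Icc 1 n, (W t ω).2 = δ n t ω)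
    (hj : ∀ t ∈ Finset.Icc 1 n, |(W t ω).1 * η t ω| ≤ c) (x : ℝ) :
    |Vtilde η γ δ n x ω - Jtilde g γ δ n x ω -
      centeredSum (volume.withDensity fun x => ENNReal.ofReal (g x)) η W n
        (piece c (Set.Iio (squash x))) ω| ≤ K * (r ^ κ * M / c ^ (1 + κ)) := by
  refine le_trans ?_ (T.sum_abs_integral_sub_piece_le hK hr hr0 hc
    (measurableSet_Iio (a := squash x)) ω)
  refine le_trans (le_of_eq ?_) (Finset.abs_sum_le_sum_abs _ _)
  rw [← abs_neg, Vtilde, Jtilde, centeredSum, Finset.mul_sum, Finset.mul_sum,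
    ← Finset.sum_sub_distrib, ← Finset.sum_sub_distrib, ← Finset.sum_neg_distrib]
  congr 1
  refine Finset.sum_congr rfl fun t ht => ?_
  rw [← mu_eq_integral_Iio hg (hd t ω), hW2 t ht, hW1 t ht]
  have h1 : piece c (Set.Iio (squash x)) (W t ω, η t ω) =
      (√(n : ℝ))⁻¹ * (γ n t ω * η t ω * (Set.Iio (x + x * δ n t ω)).indicator 1 (η t ω)) := by
    have h2 := lt_mul_iff_squash_lt (hd t ω) x (η t ω)
    rw [hW2 t ht] at h2
    rw [piece, trunc, if_pos (hj t ht), hW2 t ht, hW1 t ht]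
    simp only [Set.indicator_apply, Set.mem_Iio, h2, Pi.one_apply]
    ring
  rw [h1]
  ring

theorem abs_Vstar_sub_Jstar_sub_le (hg : IsCenteredPosDensity g)
    (T : TameLaw (volume.withDensity fun x => ENNReal.ofReal (g x)) κ M C β)
    (hK : ∀ ω, ∑ t ∈ Finset.Icc 1 n, (W t ω).1 ^ 2 ≤ K) (hr : ∀ t ω, |(W t ω).1| ≤ r)
    (hr0 : 0 ≤ r) (hc : 0 < c)
    (hW1 : ∀ t ∈ Finset.Icc 1 n, (W t ω).1 = (√(n : ℝ))⁻¹ * γ n t ω)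
    (hj : ∀ t ∈ Finset.Icc 1 n, |(W t ω).1 * η t ω| ≤ c) (x : ℝ) :
    |Vstar η γ n x ω - Jstar g γ n x ω -
      centeredSum (volume.withDensity fun x => ENNReal.ofReal (g x)) η (unperturbed W) n
        (piece c (Set.Iic (squash x))) ω| ≤ K * (r ^ κ * M / c ^ (1 + κ)) := by
  refine le_trans ?_ (T.sum_abs_integral_sub_piece_le (W := unperturbed W) hK hr hr0 hc
    (measurableSet_Iic (a := squash x)) ω)
  refine le_trans (le_of_eq ?_) (Finset.abs_sum_le_sum_abs _ _)
  rw [← abs_neg, Vstar, Jstar, centeredSum, Finset.mul_sum, Finset.mul_sum,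
    ← Finset.sum_sub_distrib, ← Finset.sum_sub_distrib, ← Finset.sum_neg_distrib]
  congr 1
  refine Finset.sum_congr rfl fun t ht => ?_
  have hj := hj t ht
  simp only [unperturbed] at hj ⊢
  rw [← mu_eq_integral_Iic hg, hW1 t ht]
  have h1 : piece c (Set.Iic (squash x)) (((√(n : ℝ))⁻¹ * γ n t ω, 0), η t ω) =
      (√(n : ℝ))⁻¹ * (γ n t ω * η t ω * (Set.Iic x).indicator 1 (η t ω)) := by
    rw [hW1 t ht] at hj
    rw [piece, trunc, if_pos hj]
    simp only [Set.indicator_apply, Set.mem_Iic, add_zero, div_one, squash_strictMono.le_iff_le,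
      Pi.one_apply]
    ring
  rw [h1]
  ring

end

/-! ### Probabilities of large weights and of a large sum of squares. -/

section

variable {Ω : Type*} [mΩ : MeasurableSpace Ω] {P : Measure Ω} {γ δ : ℕ → ℕ → Ω → ℝ} {q a : ℝ}

theorem measure_exists_weight_gt_le {n : ℕ} (hγ : ∀ t, 1 ≤ t → t ≤ n → Measurable (γ n t))
    (hq : 0 < q) {L : ℝ} (hL : 0 < L) :
    P {ω | ∃ t ∈ Finset.Icc 1 n, L < |γ n t ω|} ≤
      weightMoment P γ q n / ENNReal.ofReal (L ^ q) := by
  have hLq : 0 < L ^ q := Real.rpow_pos_of_pos hL _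
  have hU : {ω | ∃ t ∈ Finset.Icc 1 n, L < |γ n t ω|} ⊆
      ⋃ t ∈ Finset.Icc 1 n, {ω | L < |γ n t ω|} := by
    rintro ω ⟨t, ht, hω⟩
    exact Set.mem_biUnion ht hω
  refine (measure_mono hU).trans ((measure_biUnion_finset_le _ _).trans ?_)
  rw [weightMoment, div_eq_mul_inv, Finset.sum_mul]
  refine Finset.sum_le_sum fun t ht => ?_
  rw [Finset.mem_Icc] at ht
  have hm := hγ t ht.1 ht.2
  rw [← div_eq_mul_inv]
  refine le_trans (measure_mono fun ω hω => ?_) (meas_ge_le_lintegral_div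
    (f := fun ω => ENNReal.ofReal (|γ n t ω| ^ q))
    ((measurable_abs.comp hm).pow_const q).ennreal_ofReal.aemeasurable
    (ENNReal.ofReal_pos.2 hLq).ne' ENNReal.ofReal_ne_top)
  exact ENNReal.ofReal_le_ofReal (Real.rpow_le_rpow hL.le (le_of_lt hω) hq.le)

theorem measure_sum_sq_gt_le {n : ℕ} (hγ : ∀ t, 1 ≤ t → t ≤ n → Measurable (γ n t))
    (hq : 0 < q) {K : ℝ} (hK : 0 < K) (hn : 0 < n) :
    P {ω | n * K < ∑ t ∈ Finset.Icc 1 n, γ n t ω ^ 2} ≤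
      (∫⁻ ω, ENNReal.ofReal (((n : ℝ)⁻¹ * ∑ t ∈ Finset.Icc 1 n, γ n t ω ^ 2) ^ (q / 2)) ∂P)
        / ENNReal.ofReal (K ^ (q / 2)) := by
  have hKq : 0 < K ^ (q / 2) := Real.rpow_pos_of_pos hK _
  have hS : Measurable fun ω => ∑ t ∈ Finset.Icc 1 n, γ n t ω ^ 2 :=
    Finset.measurable_fun_sum _ fun t ht =>
      (hγ t (Finset.mem_Icc.1 ht).1 (Finset.mem_Icc.1 ht).2).pow_const 2
  refine le_trans (measure_mono fun ω hω => ?_) (meas_ge_le_lintegral_div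
    ((hS.const_mul _).pow_const (q / 2)).ennreal_ofReal.aemeasurable
    (ENNReal.ofReal_pos.2 hKq).ne' ENNReal.ofReal_ne_top)
  refine ENNReal.ofReal_le_ofReal (Real.rpow_le_rpow hK.le ?_ (by positivity))
  have hω : n * K < ∑ t ∈ Finset.Icc 1 n, γ n t ω ^ 2 := hω
  have hn' : (0 : ℝ) < n := by exact_mod_cast hn
  rw [← div_eq_inv_mul, le_div_iff₀ hn']
  linarith

theorem exists_measure_sum_sq_gt_le (hγ : ∀ n t, 1 ≤ t → t ≤ n → Measurable (γ n t))
    (hw : WeightConditions P γ δ q a) {θ : ℝ≥0∞} (hθ : 0 < θ) :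
    ∃ K : ℝ, 0 < K ∧ ∀ᶠ n : ℕ in atTop,
      P {ω | n * K < ∑ t ∈ Finset.Icc 1 n, γ n t ω ^ 2} ≤ θ := by
  obtain ⟨B, hB⟩ := hw.moment_bounded
  have hq : 0 < q := by linarith [hw.two_lt]
  have ht : Tendsto (fun K : ℝ => (B : ℝ≥0∞) / ENNReal.ofReal (K ^ (q / 2))) atTop (𝓝 0) := by
    have h1 := ENNReal.tendsto_ofReal_atTop.comp (tendsto_rpow_atTop (y := q / 2) (by positivity))
    have := ENNReal.Tendsto.const_div h1 (Or.inr (ENNReal.coe_ne_top (r := B)))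
    simpa using this
  obtain ⟨K, hK1, hK2⟩ := ((ht.eventually_le_const hθ).and (eventually_gt_atTop 0)).exists
  refine ⟨K, hK2, ?_⟩
  filter_upwards [hB, eventually_gt_atTop 0] with n hn hn0
  exact (measure_sum_sq_gt_le (hγ n) hq hK2 hn0).trans
    ((ENNReal.div_le_div_right hn _).trans hK1)

/-- The threshold is chosen so that its `q`-th power is `n^{q/2 - a}`, the rate in the assumption on
`C_n`. -/
theorem eventually_measure_exists_weight_gt_le
    (hγ : ∀ n t, 1 ≤ t → t ≤ n → Measurable (γ n t))
    (hw : WeightConditions P γ δ q a) {θ : ℝ≥0∞} (hθ : 0 < θ) :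
    ∀ᶠ n : ℕ in atTop,
      P {ω | ∃ t ∈ Finset.Icc 1 n, (n : ℝ) ^ (1 / 2 - a / q) < |γ n t ω|} ≤ θ := by
  have hq : 0 < q := by linarith [hw.two_lt]
  filter_upwards [hw.moment_rate.eventually_le_const hθ, eventually_gt_atTop 0] with n hn hn0
  have hn' : (0 : ℝ) < n := by exact_mod_cast hn0
  refine (measure_exists_weight_gt_le (hγ n) hq (Real.rpow_pos_of_pos hn' _)).trans
    (le_trans (le_of_eq ?_) hn)
  rw [← Real.rpow_mul hn'.le, ← ENNReal.ofReal_rpow_of_pos hn', ENNReal.ofReal_natCast]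
  congr 2
  field_simp

end

/-! ### Choice of the chaining and coarse-grid parameters. -/

theorem tendsto_natCast_rpow_zero {b : ℝ} (hb : b < 0) :
    Tendsto (fun n : ℕ => (n : ℝ) ^ b) atTop (𝓝 0) := by
  have := (tendsto_rpow_neg_atTop (y := -b) (by linarith)).comp tendsto_natCast_atTop_atTop
  simpa [Function.comp_def] using this

/-- The base of the exponential rates and the finest dyadic level used in the chaining. -/
theorem exists_chain_params {β b : ℝ} (hβ : 0 < β) (hb : 0 < b) :
    ∃ s : ℝ, 1 < s ∧ s ^ 4 ≤ 2 ^ β ∧ ∃ k : ℕ → ℕ, Tendsto k atTop atTop ∧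
      (∀ᶠ n : ℕ in atTop, 2 * s ^ (2 * k n) * (n : ℝ) ^ (-b) ≤ 1) ∧
      ∀ n : ℕ, 0 < n → ((2 : ℝ) ^ k n)⁻¹ ^ β ≤ (n : ℝ) ^ (-2 : ℝ) := by
  set N := ⌈2 / β⌉₊ with hN
  have hN1 : 2 / β ≤ N := Nat.le_ceil _
  have hN0 : (0 : ℝ) < N := lt_of_lt_of_le (by positivity) hN1
  have hN0' : 0 < N := by exact_mod_cast hN0
  -- Here `s = 2^{β'/2}` and `k n = N (log₂ n + 1)`. Then `N ≥ 2/β` gives `2^{-kβ} ≤ n^{-2}`, `β' ≤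
  -- β/2` gives `s⁴ ≤ 2^β`, and `β' ≤ b/(2N)` gives `s^{2k} ≤ (2n)^{b/2}`, which `n^{-b}` absorbs.
  set β' := min (β / 2) (b / (2 * N)) with hβ'
  have hβ'0 : 0 < β' := by positivity
  refine ⟨2 ^ (β' / 2), Real.one_lt_rpow (by norm_num) (by positivity), ?_,
    fun n => N * (Nat.log 2 n + 1), ?_, ?_, fun n hn => ?_⟩
  · rw [← Real.rpow_natCast, ← Real.rpow_mul (by norm_num)]
    refine Real.rpow_le_rpow_of_exponent_le (by norm_num) ?_
    push_cast
    linarith [min_le_left (β / 2) (b / (2 * N))]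
  · refine tendsto_atTop_atTop.2 fun m => ⟨2 ^ m, fun n hn => ?_⟩
    have h1 : m ≤ Nat.log 2 n := Nat.le_log_of_pow_le one_lt_two hn
    exact (h1.trans (Nat.le_succ _)).trans (Nat.le_mul_of_pos_left _ hN0')
  · have ht : Tendsto (fun n : ℕ => 2 * 2 ^ (b / 2) * (n : ℝ) ^ (-(b / 2))) atTop (𝓝 0) := by
      simpa using (tendsto_natCast_rpow_zero (b := -(b / 2)) (by linarith)).const_mul
        (2 * 2 ^ (b / 2))
    filter_upwards [ht.eventually_le_const one_pos, eventually_gt_atTop 0] with n h1 hn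
    refine le_trans ?_ h1
    have hn1 : (1 : ℝ) ≤ n := by exact_mod_cast hn
    have hn0 : (0 : ℝ) < n := by linarith
    have hp : (2 : ℝ) ^ (Nat.log 2 n + 1) ≤ 2 * n := by
      rw [pow_succ, mul_comm]
      have : ((2 ^ Nat.log 2 n : ℕ) : ℝ) ≤ n := by
        exact_mod_cast Nat.pow_log_le_self 2 hn.ne'
      push_cast at this
      linarith
    have e1 : ((2 : ℝ) ^ (β' / 2)) ^ (2 * (N * (Nat.log 2 n + 1)))
        = ((2 : ℝ) ^ (Nat.log 2 n + 1)) ^ (N * β') := by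
      rw [← Real.rpow_natCast, ← Real.rpow_natCast 2 (Nat.log 2 n + 1),
        ← Real.rpow_mul (by norm_num), ← Real.rpow_mul (by norm_num)]
      congr 1
      push_cast
      ring
    have e2 : N * β' ≤ b / 2 := by
      have := min_le_right (β / 2) (b / (2 * N))
      calc N * β' ≤ N * (b / (2 * N)) := by gcongr
        _ = b / 2 := by field_simp
    have e3 : ((2 : ℝ) ^ (Nat.log 2 n + 1)) ^ (N * β') ≤ 2 ^ (b / 2) * (n : ℝ) ^ (b / 2) := by
      rw [← Real.mul_rpow (by norm_num) hn0.le]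
      exact (Real.rpow_le_rpow (by positivity) hp (by positivity)).trans
        (Real.rpow_le_rpow_of_exponent_le (by linarith) e2)
    rw [e1]
    calc _ ≤ 2 * (2 ^ (b / 2) * (n : ℝ) ^ (b / 2)) * (n : ℝ) ^ (-b) := by gcongr
      _ = 2 * 2 ^ (b / 2) * ((n : ℝ) ^ (b / 2) * (n : ℝ) ^ (-b)) := by ring
      _ = _ := by rw [← Real.rpow_add hn0]; ring_nf
  · have hn1 : (1 : ℝ) ≤ n := by exact_mod_cast hn
    have hn0 : (0 : ℝ) < n := by linarith
    have hp : (n : ℝ) ≤ 2 ^ (Nat.log 2 n + 1) := by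
      exact_mod_cast (Nat.lt_pow_succ_log_self (by norm_num) n).le
    rw [Real.inv_rpow (by positivity), Real.rpow_neg hn0.le]
    refine inv_anti₀ (by positivity) ?_
    change (n : ℝ) ^ (2 : ℝ) ≤ ((2 : ℝ) ^ (N * (Nat.log 2 n + 1))) ^ β
    rw [mul_comm N, pow_mul, ← Real.rpow_natCast _ N, ← Real.rpow_mul (by positivity)]
    calc (n : ℝ) ^ (2 : ℝ) ≤ (n : ℝ) ^ (N * β) := by
          refine Real.rpow_le_rpow_of_exponent_le hn1 ?_
          rwa [div_le_iff₀ hβ] at hN1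
      _ ≤ _ := by gcongr

/-- With `Δ = l^{-2/β} / 2` one has `l² (2Δ)^β = 1`, so the exponent is `-l ε + D`, and a large `l`
beats the number `2^m` of coarse points. -/
theorem exists_coarse_params {β ε D : ℝ} (hβ : 0 < β) (hε : 0 < ε) (m : ℕ) {θ : ℝ≥0∞}
    (hθ : 0 < θ) : ∃ l Δ : ℝ, 0 ≤ l ∧ 0 < Δ ∧ 2 * Δ ≤ 1 ∧
      2 ^ m * ENNReal.ofReal (2 * Real.exp (-l * ε + l ^ 2 * (D * (2 * Δ) ^ β))) ≤ θ := by
  have h1 : Tendsto (fun l : ℝ => -l * ε + D) atTop atBot :=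
    tendsto_atBot_add_const_right _ _ (tendsto_neg_atTop_atBot.atBot_mul_const hε)
  have h2 : Tendsto (fun l : ℝ => 2 ^ m * ENNReal.ofReal (2 * Real.exp (-l * ε + D))) atTop
      (𝓝 0) := by
    have h3 := ENNReal.tendsto_ofReal ((Real.tendsto_exp_atBot.comp h1).const_mul 2)
    have := ENNReal.Tendsto.const_mul (a := 2 ^ m) h3 (Or.inr (by simp))
    simpa using this
  obtain ⟨l, hl1, hl2⟩ := ((h2.eventually_le_const hθ).and (eventually_ge_atTop 1)).exists
  have hl0 : 0 < l := by linarith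
  refine ⟨l, l ^ (-(2 / β)) / 2, hl0.le, by positivity, ?_, ?_⟩
  · rw [mul_div_cancel₀ _ two_ne_zero]
    exact Real.rpow_le_one_of_one_le_of_nonpos hl2 (by simp; positivity)
  · rw [mul_div_cancel₀ _ two_ne_zero, ← Real.rpow_mul hl0.le,
      show -(2 / β) * β = -2 by field_simp, Real.rpow_neg hl0.le, Real.rpow_two]
    rw [show l ^ 2 * (D * (l ^ 2)⁻¹) = D by field_simp]
    exact hl1

/-! ### Assembly of the uniform bound for `Vtilde`. -/

section

variable {Ω : Type*} [mΩ : MeasurableSpace Ω] {P : Measure Ω} [IsProbabilityMeasure P]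
  {g : ℝ → ℝ} {η : ℕ → Ω → ℝ} {γ δ : ℕ → ℕ → Ω → ℝ} {A : ℕ → ℕ → MeasurableSpace Ω}

/-- The five exceptional events: a large weight, a large sum of squares, a large perturbation, a
large jump, and a large deviation of the truncated processes. -/
theorem measure_sup_Vtilde_sub_le
    [IsProbabilityMeasure (volume.withDensity fun x => ENNReal.ofReal (g x))]
    (hg : IsCenteredPosDensity g) (hsetup : Setup P g η γ δ A)
    (hind : ∀ n t, 1 ≤ t → t ≤ n → Indep (MeasurableSpace.comap (η t) inferInstance) (A n t) P)
    {κ M C β : ℝ} (T : TameLaw (volume.withDensity fun x => ENNReal.ofReal (g x)) κ M C β)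
    {n : ℕ} {K L r Δ c l ε s τ ε₀ : ℝ} (hK : 0 ≤ K) (hL : 0 ≤ L) (hr0 : 0 ≤ r)
    (hLr : (√(n : ℝ))⁻¹ * L ≤ r) (hΔ : 0 < Δ) (hΔ1 : 2 * Δ ≤ 1) (hc : 0 < c) (hl : 0 ≤ l)
    (hlc : 2 * l * c ≤ 1) (hε : 0 < ε) (hτ : 0 < τ) (hs : 1 < s) (hsβ : s ^ 4 ≤ 2 ^ β)
    {k₀ k₁ : ℕ} (hk : k₀ ≤ k₁) (hkc : 2 * s ^ (2 * k₁) * c ≤ 1) (hε₀ : 0 < ε₀)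
    (hsmall : ε + 2 * (ε / (1 - s⁻¹) + ε
          + 2 * (n * τ + K / τ * (C * ((2 : ℝ) ^ k₁)⁻¹ ^ β)))
      + 2 * (K * (r ^ κ * M / c ^ (1 + κ))) < ε₀) :
    P {ω | ENNReal.ofReal ε₀ ≤ ⨆ x : ℝ, ENNReal.ofReal |Vtilde η γ δ n x ω - Vstar η γ n x ω
        - (Jtilde g γ δ n x ω - Jstar g γ n x ω)|} ≤
      P {ω | ∃ t ∈ Finset.Icc 1 n, L < |γ n t ω|} +
      P {ω | n * K < ∑ t ∈ Finset.Icc 1 n, γ n t ω ^ 2} +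
      P {ω | ENNReal.ofReal Δ ≤ ⨆ t ∈ Finset.Icc 1 n, ENNReal.ofReal |δ n t ω|} +
      ENNReal.ofReal (K * (r ^ κ * M / c ^ (2 + κ))) +
      (4 * ∑' i, chainTerm K C ε s (i + k₀) +
        2 ^ k₀ * ENNReal.ofReal (2 * Real.exp (-l * ε + l ^ 2 * (K * (C * (2 * Δ) ^ β))))) := by
  set W := truncArray n L (n * K) Δ (γ n) (δ n) with hW
  set ν := volume.withDensity fun x => ENNReal.ofReal (g x) with hν
  have H : AdaptedArray P ν η W (A n) n := hsetup.adaptedArray hind n L (n * K) Δ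
  have hKW : ∀ ω, ∑ t ∈ Finset.Icc 1 n, (W t ω).1 ^ 2 ≤ K := sum_truncArray_sq_le hK _ _
  have hrW : ∀ t ω, |(W t ω).1| ≤ r := fun t ω => by
    simp only [hW, truncArray]
    rw [abs_mul, abs_of_nonneg (by positivity : 0 ≤ (√(n : ℝ))⁻¹)]
    exact (mul_le_mul_of_nonneg_left (abs_truncWeight_le hL _ _ _) (by positivity)).trans hLr
  have hdW : ∀ t ω, |(W t ω).2| ≤ Δ := fun t ω => abs_trunc_le hΔ.le _
  have hd1 : ∀ t ω, |(W t ω).2| ≤ 1 / 2 := fun t ω => (hdW t ω).trans (by linarith)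
  have b4 := T.measure_exists_jump_le H hKW hrW hr0 hc
  have b5 := T.measure_exists_perturbation_le H hKW hK hΔ hΔ1 hdW hc.le hl hlc hε hτ hs hsβ hk hkc
  set E := K * (r ^ κ * M / c ^ (1 + κ)) with hE
  set thr := ε + 2 * (ε / (1 - s⁻¹) + ε
    + 2 * (n * τ + K / τ * (C * ((2 : ℝ) ^ k₁)⁻¹ ^ β))) with hthr
  refine le_trans (measure_mono fun ω hω => ?_) ((measure_union_le _ _).trans
    (add_le_add ((measure_union_le _ _).trans (add_le_add ((measure_union_le _ _).trans
      (add_le_add (measure_union_le _ _) le_rfl)) b4)) b5))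
  by_contra hcon
  simp only [Set.mem_union, not_or] at hcon
  obtain ⟨⟨⟨⟨h1, h2⟩, h3⟩, h4⟩, h5⟩ := hcon
  have h1 : ∀ t ∈ Finset.Icc 1 n, |γ n t ω| ≤ L := fun t ht => by
    by_contra h; exact h1 ⟨t, ht, not_le.1 h⟩
  have h2 : ∑ t ∈ Finset.Icc 1 n, γ n t ω ^ 2 ≤ n * K := not_lt.1 h2
  have h3 : (⨆ t ∈ Finset.Icc 1 n, ENNReal.ofReal |δ n t ω|) < ENNReal.ofReal Δ := not_le.1 h3
  have h4 : ∀ t ∈ Finset.Icc 1 n, |(W t ω).1 * η t ω| ≤ c := fun t ht => by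
    by_contra h; exact h4 ⟨t, ht, not_le.1 h⟩
  have hW1 : ∀ t ∈ Finset.Icc 1 n, (W t ω).1 = (√(n : ℝ))⁻¹ * γ n t ω := fun t ht => by
    simp only [hW, truncArray, truncWeight]
    rw [if_pos ⟨h1 t ht, le_trans (Finset.sum_le_sum_of_subset_of_nonneg
      (Finset.Icc_subset_Icc_right (Finset.mem_Icc.1 ht).2) fun _ _ _ => sq_nonneg _) h2⟩]
  have hW2 : ∀ t ∈ Finset.Icc 1 n, (W t ω).2 = δ n t ω := fun t ht => by
    simp only [hW, truncArray, trunc]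
    refine if_pos ?_
    have := (le_iSup₂ (f := fun t (_ : t ∈ Finset.Icc 1 n) => ENNReal.ofReal |δ n t ω|) t
      ht).trans_lt h3
    exact ((ENNReal.ofReal_lt_ofReal_iff hΔ).1 this).le
  have hle : ∀ x, |Vtilde η γ δ n x ω - Vstar η γ n x ω
      - (Jtilde g γ δ n x ω - Jstar g γ n x ω)| ≤ thr + 2 * E := fun x => by
    have g1 := abs_Vtilde_sub_Jtilde_sub_le hg T hKW hrW hr0 hc hd1 hW1 hW2 h4 x
    have g2 := abs_Vstar_sub_Jstar_sub_le hg T hKW hrW hr0 hc hW1 h4 x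
    have g3 : |centeredSum ν η W n (piece c (Set.Iio (squash x))) ω
        - centeredSum ν η (unperturbed W) n (piece c (Set.Iic (squash x))) ω| < thr := by
      by_contra h
      exact h5 ⟨squash x, (squash_pos x).le, squash_lt_one x, not_lt.1 h⟩
    rw [← hE] at g1 g2
    rw [abs_le] at g1 g2 ⊢
    rw [abs_lt] at g3
    constructor <;> linarith [g1.1, g1.2, g2.1, g2.2, g3.1, g3.2]
  have hfin : ENNReal.ofReal ε₀ ≤ ENNReal.ofReal (thr + 2 * E) :=
    le_trans hω (iSup_le fun x => ENNReal.ofReal_le_ofReal (hle x))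
  exact absurd hfin (not_le.2 ((ENNReal.ofReal_lt_ofReal_iff hε₀).2 hsmall))

theorem isLittleOPOne_Vtilde_sub {q a : ℝ} (hg : IsCenteredPosDensity g) (hA1 : AssumptionA1 g)
    (hsetup : Setup P g η γ δ A) (hw : WeightConditions P γ δ q a)
    (hind : ∀ n t, 1 ≤ t → t ≤ n →
      Indep (MeasurableSpace.comap (η t) inferInstance) (A n t) P) :
    IsLittleOPOne P (fun n ω => ⨆ x : ℝ, ENNReal.ofReal |Vtilde η γ δ n x ω - Vstar η γ n x ω
        - (Jtilde g γ δ n x ω - Jstar g γ n x ω)|) := by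
  have hprob : IsProbabilityMeasure (volume.withDensity fun x => ENNReal.ofReal (g x)) := by
    rw [← hsetup.law_eta 1 le_rfl]
    exact Measure.isProbabilityMeasure_map (hsetup.measurable_eta 1 le_rfl).aemeasurable
  obtain ⟨κ, M, C, β, T⟩ := exists_tameLaw hg hA1
  have hκ := T.kappa_pos
  have hq : 0 < q := by linarith [hw.two_lt]
  have ha := hw.a_pos
  have hγm : ∀ n t, 1 ≤ t → t ≤ n → Measurable (γ n t) := fun n t h1 h2 =>
    (hsetup.adapted_gamma n t t h1 le_rfl h2).mono (hsetup.sub n t h1 h2) le_rfl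
  set b₁ := a / q with hb₁
  have hb₁0 : 0 < b₁ := by positivity
  -- Jump level `c = n^{-b}` and weight bound `r = n^{-b₁}`: this `b` makes `r^κ / c^{2+κ} =
  -- n^{-b₁κ/2}`, so both truncation errors vanish while `c → 0`.
  set b := b₁ * κ / (2 * (2 + κ)) with hb
  have hb0 : 0 < b := by positivity
  obtain ⟨s, hs, hsβ, k, hk, hkc, hkn⟩ := exists_chain_params T.beta_pos hb0
  refine isLittleOPOne_of_eventually_le fun ε₀ hε₀ θ hθ => ?_
  have hs1 : 0 < 1 - s⁻¹ := by linarith [inv_lt_one_of_one_lt₀ hs]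
  have hθ6 : 0 < θ / 6 := ENNReal.div_pos hθ.ne' (by simp)
  obtain ⟨K, hK, hE2⟩ := exists_measure_sum_sq_gt_le hγm hw hθ6
  -- The coarse and chaining errors total `3ε + 2ε/(1 - s⁻¹) = ε₀/2`. The finest-level and
  -- truncation errors will add at most `ε₀/8` each.
  set ε := ε₀ / 2 / (3 + 2 / (1 - s⁻¹)) with hε
  have hε0 : 0 < ε := by positivity
  have htail : Tendsto (fun k₀ => 4 * ∑' i, chainTerm K C ε s (i + k₀)) atTop (𝓝 0) := by
    simpa using ENNReal.Tendsto.const_mul (a := 4) (tsum_chainTerm_tendsto K C hε0 hs)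
      (Or.inr (by simp))
  obtain ⟨k₀, hk₀⟩ := (htail.eventually_le_const hθ6).exists
  obtain ⟨l, Δ, hl, hΔ, hΔ1, hcoarse⟩ := exists_coarse_params (D := K * C) T.beta_pos hε0 k₀ hθ6
  simp only [mul_assoc K C] at hcoarse
  have hE3 := (hw.max_delta (ENNReal.ofReal Δ) (ENNReal.ofReal_pos.2 hΔ)).eventually_le_const hθ6
  have hrate : ∀ p : ℝ, b * p < b₁ * κ → Tendsto (fun n : ℕ =>
      K * (((n : ℝ) ^ (-b₁)) ^ κ * M / ((n : ℝ) ^ (-b)) ^ p)) atTop (𝓝 0) := fun p hp => by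
    have := (tendsto_natCast_rpow_zero (b := b * p - b₁ * κ) (by linarith)).const_mul (K * M)
    rw [mul_zero] at this
    refine this.congr' ?_
    filter_upwards [eventually_gt_atTop 0] with n hn
    have hn0 : (0 : ℝ) < n := by exact_mod_cast hn
    rw [← Real.rpow_mul hn0.le, ← Real.rpow_mul hn0.le, mul_div_right_comm, ← Real.rpow_sub hn0,
      show -b₁ * κ - -b * p = b * p - b₁ * κ by ring]
    ring
  have hbp : b * (2 + κ) = b₁ * κ / 2 := by rw [hb]; field_simp
  have hb₁κ : 0 < b₁ * κ := by positivity
  have hr1 := hrate (1 + κ) (by nlinarith)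
  have hr2 := ENNReal.tendsto_ofReal (hrate (2 + κ) (by linarith))
  rw [ENNReal.ofReal_zero] at hr2
  have hlc : Tendsto (fun n : ℕ => 2 * l * (n : ℝ) ^ (-b)) atTop (𝓝 0) := by
    simpa using (tendsto_natCast_rpow_zero (b := -b) (by linarith)).const_mul (2 * l)
  have hX : Tendsto (fun n : ℕ => (1 + K * C) * (n : ℝ) ^ (-(1 / 2) : ℝ)) atTop (𝓝 0) := by
    simpa using (tendsto_natCast_rpow_zero (b := -(1 / 2)) (by norm_num)).const_mul (1 + K * C)
  filter_upwards [hE2, hE3, eventually_measure_exists_weight_gt_le hγm hw hθ6,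
    hr1.eventually_le_const (by positivity : 0 < ε₀ / 16), hr2.eventually_le_const hθ6,
    hlc.eventually_le_const one_pos, hX.eventually_le_const (by positivity : 0 < ε₀ / 32),
    hkc, hk.eventually_ge_atTop k₀, eventually_gt_atTop 0]
    with n e2 e3 e1 er1 er2 elc eX ekc ek hn
  have hn0 : (0 : ℝ) < n := by exact_mod_cast hn
  have hLr : (√(n : ℝ))⁻¹ * (n : ℝ) ^ (1 / 2 - b₁) ≤ (n : ℝ) ^ (-b₁) := by
    rw [Real.sqrt_eq_rpow, ← Real.rpow_neg hn0.le, ← Real.rpow_add hn0]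
    ring_nf
    exact le_rfl
  -- This value of `τ` balances `nτ` and `n^{-2}/τ`, both equal to `n^{-1/2}`.
  have hτ : 0 < (n : ℝ) ^ (-(3 / 2) : ℝ) := by positivity
  have hXn : n * (n : ℝ) ^ (-(3 / 2) : ℝ) + K / (n : ℝ) ^ (-(3 / 2) : ℝ)
      * (C * ((2 : ℝ) ^ k n)⁻¹ ^ β) ≤ ε₀ / 32 := by
    refine le_trans ?_ eX
    have x1 : n * (n : ℝ) ^ (-(3 / 2) : ℝ) = (n : ℝ) ^ (-(1 / 2) : ℝ) := by
      nth_rewrite 1 [← Real.rpow_one (n : ℝ)]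
      rw [← Real.rpow_add hn0]
      norm_num
    have x2 : (n : ℝ) ^ (-2 : ℝ) / (n : ℝ) ^ (-(3 / 2) : ℝ) = (n : ℝ) ^ (-(1 / 2) : ℝ) := by
      rw [← Real.rpow_sub hn0]
      norm_num
    have hC := T.const_nonneg
    calc _ ≤ n * (n : ℝ) ^ (-(3 / 2) : ℝ) + K / (n : ℝ) ^ (-(3 / 2) : ℝ)
          * (C * (n : ℝ) ^ (-2 : ℝ)) := by
          have := hkn n hn
          gcongr
      _ = (n : ℝ) ^ (-(1 / 2) : ℝ)
          + K * C * ((n : ℝ) ^ (-2 : ℝ) / (n : ℝ) ^ (-(3 / 2) : ℝ)) := by rw [x1]; ring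
      _ = _ := by rw [x2]; ring
  have hsmall : ε + 2 * (ε / (1 - s⁻¹) + ε + 2 * (n * (n : ℝ) ^ (-(3 / 2) : ℝ)
      + K / (n : ℝ) ^ (-(3 / 2) : ℝ) * (C * ((2 : ℝ) ^ k n)⁻¹ ^ β)))
      + 2 * (K * (((n : ℝ) ^ (-b₁)) ^ κ * M / ((n : ℝ) ^ (-b)) ^ (1 + κ))) < ε₀ := by
    have : ε * (3 + 2 / (1 - s⁻¹)) = ε₀ / 2 := by
      rw [hε]
      exact div_mul_cancel₀ _ (by positivity)
    have h2 : ε + 2 * (ε / (1 - s⁻¹) + ε) = ε * (3 + 2 / (1 - s⁻¹)) := by ring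
    linarith
  refine (measure_sup_Vtilde_sub_le hg hsetup hind T hK.le (by positivity) (by positivity) hLr hΔ
    hΔ1 (by positivity) hl elc hε0 hτ hs hsβ ek ekc hε₀ hsmall).trans ?_
  calc _ ≤ θ / 6 + θ / 6 + θ / 6 + θ / 6 + (θ / 6 + θ / 6) := by gcongr
    _ = 6 * (θ / 6) := by ring
    _ = θ := ENNReal.mul_div_cancel (by simp) (by simp)

end

end MixedEmpirical

theorem mainTheorem6 {Ω : Type*} [MeasurableSpace Ω] (P : Measure Ω) [IsProbabilityMeasure P]
    (g : ℝ → ℝ) (η : ℕ → Ω → ℝ) (γ δ : ℕ → ℕ → Ω → ℝ) (A : ℕ → ℕ → MeasurableSpace Ω) (q a : ℝ)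
    (hg : MixedEmpirical.IsCenteredPosDensity g)
    (hA1 : MixedEmpirical.AssumptionA1 g)
    (hsetup : MixedEmpirical.Setup P g η γ δ A)
    (hw : MixedEmpirical.WeightConditions P γ δ q a) :
    MixedEmpirical.IsLittleOPOne P (fun n ω => ⨆ x : ℝ, ENNReal.ofReal
      |MixedEmpirical.Jtilde g γ δ n x ω - MixedEmpirical.Jstar g γ n x ω
        - MixedEmpirical.linTerm g γ δ n x ω|) ∧
    ((∀ n t, 1 ≤ t → t ≤ n → Indep (MeasurableSpace.comap (η t) inferInstance) (A n t) P) →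
      MixedEmpirical.IsLittleOPOne P (fun n ω => ⨆ x : ℝ, ENNReal.ofReal
        |MixedEmpirical.Vtilde η γ δ n x ω - MixedEmpirical.Vstar η γ n x ω
          - MixedEmpirical.linTerm g γ δ n x ω|)) := by
  have hJ := MixedEmpirical.isLittleOPOne_Jtilde
    (MixedEmpirical.integrable_id_mul_of_setup hg hA1 hsetup) hA1 hw
  refine ⟨hJ, fun hind => ?_⟩
  -- Add and subtract `Jtilde - Jstar`.
  refine (MixedEmpirical.isLittleOPOne_Vtilde_sub hg hA1 hsetup hw hind).add hJ fun n ω => ?_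
  refine iSup_le fun x => le_trans ?_ (add_le_add (le_iSup _ x) (le_iSup _ x))
  rw [← ENNReal.ofReal_add (abs_nonneg _) (abs_nonneg _)]
  refine ENNReal.ofReal_le_ofReal (le_trans (le_of_eq ?_) (abs_add_le _ _))
  congr 1
  ring
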